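/- For a polynomial $f=a_0(X-\alpha_1)\cdots(X-\alpha_n)\in\mathbb{Z}[X]$ of degree $n\ge 1$ (with $a_0\in\mathbb{Z}\setminus\{0\}$, $\alpha_i\in\overline{\mathbb{Q}}$) put $$[f](X_1,\dots,X_n)=a_0^{n-1}\prod_{i=1}^n\bigl(X_1+\alpha_iX_2+\cdots+\alpha_i^{n-1}X_n\bigr).$$ Two polynomials $f,g\in\mathbb{Z}[X]$ of the same degree $n$ are called Hermite equivalent if $[g](\mathbf{X})=\pm[f](U\mathbf{X})$ for some $U\in GL_n(\mathbb{Z})$. For an algebraic number $\alpha$ of degree $n$, let $a_0X^n+a_1X^{n-1}+\cdots+a_n\in\mathbb{Z}[X]$ be its primitive minimal polynomial (with coprime coefficients and $a_0>0$). The invariant order $\mathbb{Z}_\alpha$ is the order of $\mathbb{Q}(\alpha)$ with $\mathbb{Z}$-module basis $$1,\quad a_0\alpha,\quad a_0\alpha^2+a_1\alpha,\quad\dots,\quad a_0\alpha^{n-1}+a_1\alpha^{n-2}+\cdots+a_{n-2}\alpha,$$ and the invariant ideal is the (invertible) fractional ideal $\mathcal{I}_\alpha=\mathbb{Z}_\alpha+\alpha\mathbb{Z}_\alpha$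 of $\mathbb{Z}_\alpha$. Theorem. Let $f,g\in\mathbb{Z}[X]$ be primitive irreducible polynomials. Then the following are equivalent: (i) $f$ and $g$ are Hermite equivalent; (ii) $f$ has a root $\alpha$ and $g$ has a root $\beta$ in $\overline{\mathbb{Q}}$ such that $\mathbb{Z}_\alpha=\mathbb{Z}_\beta$ and $\mathcal{I}_\alpha$ and $\mathcal{I}_\beta$ lie in the same ideal class of $\mathbb{Z}_\alpha$. If moreover $f$ and $g$ are monic, then $f$ and $g$ are Hermite equivalent if and only if $f$ has a root $\alpha$ and $g$ has a root $\beta$ such that $\mathbb{Z}[\alpha]=\mathbb{Z}[\beta]$. -/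

import Mathlib

open Polynomial

/-- The field of algebraic numbers. -/
abbrev Qbar : Type := AlgebraicClosure ℚ

/-! ## Hermite equivalence -/

/-- For `f = a₀ (X - α₁) ⋯ (X - αₙ)` of degree `n`, the decomposable form
`[f](X₁, …, Xₙ) = a₀ ^ (n - 1) * ∏ i, (X₁ + αᵢ X₂ + ⋯ + αᵢ ^ (n - 1) Xₙ)`. Its coefficients are
rational integers; it is written here as a polynomial over the field of algebraic numbers. -/
noncomputable def decomposableForm (n : ℕ) (f : ℤ[X]) : MvPolynomial (Fin n) Qbar :=
  MvPolynomial.C ((f.leadingCoeff : Qbar) ^ (n - 1)) *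
    ((f.aroots Qbar).map fun a : Qbar =>
      ∑ i : Fin n, MvPolynomial.C (a ^ (i : ℕ)) * MvPolynomial.X i).prod

/-- The form `F(U X)`, for an integral matrix `U` and the column vector `X` of the variables. -/
noncomputable def substMatrix {n : ℕ} (U : Matrix (Fin n) (Fin n) ℤ)
    (F : MvPolynomial (Fin n) Qbar) : MvPolynomial (Fin n) Qbar :=
  MvPolynomial.bind₁
    (fun i => ∑ j : Fin n, MvPolynomial.C ((U i j : ℤ) : Qbar) * MvPolynomial.X j) F

/-- Two integral polynomials of the same degree `n` are Hermite equivalent if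
`[g](X) = ± [f](U X)` for some `U ∈ GLₙ(ℤ)`. -/
def HermiteEquivalent (f g : ℤ[X]) : Prop :=
  ∃ n : ℕ, f.natDegree = n ∧ g.natDegree = n ∧ ∃ U : Matrix.GeneralLinearGroup (Fin n) ℤ,
    decomposableForm n g = substMatrix U.val (decomposableForm n f) ∨
    decomposableForm n g = -substMatrix U.val (decomposableForm n f)

/-! ## The invariant order and the invariant ideal of an algebraic number -/

theorem isAlgebraic_rat_Qbar (α : Qbar) : IsAlgebraic ℚ α := by
  convert (AlgebraicClosure.isAlgebraic ℚ).isAlgebraic α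
  · rfl
  · exact Subsingleton.elim _ _

theorem exists_primMinpoly (α : Qbar) :
    ∃ p : ℤ[X], p.IsPrimitive ∧ Irreducible p ∧ 0 < p.leadingCoeff ∧ aeval α p = 0 := by
  have halg : IsAlgebraic ℤ α :=
    (IsFractionRing.isAlgebraic_iff ℤ ℚ Qbar).mpr (isAlgebraic_rat_Qbar α)
  obtain ⟨q, hq0, hq⟩ := halg
  have hprime : (RingHom.ker (aeval (R := ℤ) α).toRingHom).IsPrime := RingHom.ker_isPrime _
  obtain ⟨p, hp, hpp⟩ := Ideal.IsPrime.exists_mem_prime_of_ne_bot hprime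
    (fun h => hq0 (by
      have : q ∈ RingHom.ker (aeval (R := ℤ) α).toRingHom := hq
      rwa [h, Ideal.mem_bot] at this))
  have hp : aeval α p = 0 := hp
  have hdeg : p.natDegree ≠ 0 := by
    intro h
    rw [natDegree_eq_zero] at h
    obtain ⟨c, rfl⟩ := h
    have hc : c ≠ 0 := fun h => hpp.ne_zero (by simp [h])
    simp [hc] at hp
  have hprim : p.IsPrimitive := hpp.irreducible.isPrimitive hdeg
  rcases lt_or_gt_of_ne (leadingCoeff_ne_zero.mpr hpp.ne_zero) with h | h
  · refine ⟨-p, ?_, hpp.neg.irreducible, by simpa using h, by simp [hp]⟩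
    intro c hc
    exact hprim c ((dvd_neg).mp hc)
  · exact ⟨p, hprim, hpp.irreducible, h, hp⟩

/-- The primitive minimal polynomial of `α`: the minimal polynomial of `α` with coprime integer
coefficients and positive leading coefficient. -/
noncomputable def primMinpoly (α : Qbar) : ℤ[X] := (exists_primMinpoly α).choose

theorem primMinpoly_spec (α : Qbar) :
    (primMinpoly α).IsPrimitive ∧ Irreducible (primMinpoly α) ∧
      0 < (primMinpoly α).leadingCoeff ∧ aeval α (primMinpoly α) = 0 :=
  (exists_primMinpoly α).choose_spec

/-- The degree of an algebraic number. -/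
noncomputable def algDegree (α : Qbar) : ℕ := (primMinpoly α).natDegree

/-- With `a₀ X ^ n + a₁ X ^ (n - 1) + ⋯ + aₙ` the primitive minimal polynomial of `α`, this is
`a₀ α ^ k + a₁ α ^ (k - 1) + ⋯ + a₍ₖ₋₁₎ α`. -/
noncomputable def orderBasis (α : Qbar) (k : ℕ) : Qbar :=
  ∑ i ∈ Finset.range k, ((primMinpoly α).coeff (algDegree α - i) : Qbar) * α ^ (k - i)

/-- The `ℤ`-module generated by
`1, a₀ α, a₀ α ^ 2 + a₁ α, …, a₀ α ^ (n - 1) + a₁ α ^ (n - 2) + ⋯ + a₍ₙ₋₂₎ α`. -/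
noncomputable def invariantModule (α : Qbar) : Submodule ℤ Qbar :=
  Submodule.span ℤ (insert 1 (orderBasis α '' Set.Ico 1 (algDegree α)))

/-- The `ℤ`-module generated by `1, α, …, α ^ (n - 1)`, with `n` the degree of `α`. -/
noncomputable def powerModule (α : Qbar) : Submodule ℤ Qbar :=
  Submodule.span ℤ ((fun i : ℕ => α ^ i) '' Set.Iio (algDegree α))

theorem primMinpoly_dvd {α : Qbar} {p : ℤ[X]} (hp : aeval α p = 0) : primMinpoly α ∣ p := by
  obtain ⟨h1, h2, -, h4⟩ := primMinpoly_spec α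
  rw [h1.dvd_iff_fraction_map_dvd_fraction_map ℚ]
  have hirr := (h1.irreducible_iff_irreducible_map_fraction_map (K := ℚ)).mp h2
  have key : ∀ q : ℤ[X], aeval α q = 0 → minpoly ℚ α ∣ q.map (algebraMap ℤ ℚ) := fun q hq =>
    minpoly.dvd ℚ α (by rwa [aeval_map_algebraMap])
  have hint : IsIntegral ℚ α := (isAlgebraic_rat_Qbar α).isIntegral
  exact ((minpoly.irreducible hint).associated_of_dvd hirr (key _ h4)).symm.dvd.trans (key _ hp)

theorem algDegree_pos (α : Qbar) : 0 < algDegree α := by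
  obtain ⟨-, -, h3, h4⟩ := primMinpoly_spec α
  rw [Nat.pos_iff_ne_zero]
  intro h
  rw [algDegree, natDegree_eq_zero] at h
  obtain ⟨c, hc⟩ := h
  rw [← hc, aeval_C, eq_intCast, Int.cast_eq_zero] at h4
  rw [← hc, h4] at h3
  simp at h3

theorem mem_powerModule {α x : Qbar} :
    x ∈ powerModule α ↔ ∃ p : ℤ[X], p.natDegree < algDegree α ∧ aeval α p = x := by
  constructor
  · intro hx
    induction hx using Submodule.span_induction with
    | mem x h =>
      obtain ⟨i, hi, rfl⟩ := h
      exact ⟨X ^ i, by simpa using hi, by simp⟩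
    | zero => exact ⟨0, by simpa using algDegree_pos α, by simp⟩
    | add x y _ _ hx hy =>
      obtain ⟨p, hp, rfl⟩ := hx
      obtain ⟨q, hq, rfl⟩ := hy
      exact ⟨p + q, (natDegree_add_le p q).trans_lt (max_lt hp hq), by simp⟩
    | smul c x _ hx =>
      obtain ⟨p, hp, rfl⟩ := hx
      exact ⟨c • p, (natDegree_smul_le c p).trans_lt hp, by simp⟩
  · rintro ⟨p, hp, rfl⟩
    rw [aeval_eq_sum_range]
    refine Submodule.sum_mem _ fun i hi => Submodule.smul_mem _ _ (Submodule.subset_span ⟨i, ?_, rfl⟩)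
    simp only [Finset.mem_range] at hi
    simp only [Set.mem_Iio]
    omega

/-- The polynomial whose value at `α` is `orderBasis α k`. -/
noncomputable def orderBasisPoly (α : Qbar) (k : ℕ) : ℤ[X] :=
  ∑ i ∈ Finset.range k, C ((primMinpoly α).coeff (algDegree α - i)) * X ^ (k - i)

theorem aeval_orderBasisPoly (α : Qbar) (k : ℕ) :
    aeval α (orderBasisPoly α k) = orderBasis α k := by
  simp [orderBasisPoly, orderBasis]

theorem coeff_orderBasisPoly (α : Qbar) {k : ℕ} (hk : k < algDegree α) (m : ℕ) :
    (orderBasisPoly α k).coeff m =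
      if 1 ≤ m ∧ m ≤ k then (primMinpoly α).coeff (algDegree α - k + m) else 0 := by
  simp only [orderBasisPoly, finsetSum_coeff, coeff_C_mul, coeff_X_pow, mul_ite, mul_one, mul_zero]
  split_ifs with h
  · rw [Finset.sum_eq_single (k - m)]
    · rw [if_pos (by omega)]
      congr 1
      omega
    · intro b hb hne
      simp only [Finset.mem_range] at hb
      rw [if_neg (by omega)]
    · intro hn
      simp only [Finset.mem_range] at hn
      omega
  · refine Finset.sum_eq_zero fun b hb => ?_
    simp only [Finset.mem_range] at hb
    rw [if_neg (by omega)]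

theorem orderBasis_mul_pow_mem (α : Qbar) {k j : ℕ} (hk : k < algDegree α)
    (hj : j < algDegree α) : orderBasis α k * α ^ j ∈ powerModule α := by
  obtain ⟨-, -, -, h4⟩ := primMinpoly_spec α
  rw [mem_powerModule]
  by_cases hkj : k + j < algDegree α
  · refine ⟨orderBasisPoly α k * X ^ j, ?_, by simp [aeval_orderBasisPoly]⟩
    refine natDegree_mul_le.trans_lt ?_
    have : (orderBasisPoly α k).natDegree ≤ k := by
      rw [natDegree_le_iff_coeff_eq_zero]
      intro m hm
      rw [coeff_orderBasisPoly α hk, if_neg (by omega)]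
    rw [natDegree_X_pow]
    omega
  · refine ⟨orderBasisPoly α k * X ^ j - X ^ (k + j - algDegree α) * primMinpoly α, ?_,
      by simp [aeval_orderBasisPoly, h4]⟩
    rw [Nat.lt_iff_le_pred (algDegree_pos α), natDegree_le_iff_coeff_eq_zero]
    intro m hm
    rw [coeff_sub, coeff_mul_X_pow', coeff_X_pow_mul', if_pos (by omega), if_pos (by omega),
      coeff_orderBasisPoly α hk]
    split_ifs with h
    · rw [sub_eq_zero]
      congr 1
      omega
    · rw [zero_sub, neg_eq_zero]
      exact coeff_eq_zero_of_natDegree_lt (by change algDegree α < _; omega)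

theorem mem_invariantModule_of_natDegree_le (α : Qbar) (m : ℕ) (hm : m < algDegree α) :
    ∀ p : ℤ[X], p.natDegree ≤ m → (∀ y ∈ powerModule α, aeval α p * y ∈ powerModule α) →
      aeval α p ∈ invariantModule α := by
  induction m with
  | zero =>
    intro p hp _
    rw [Nat.le_zero, natDegree_eq_zero] at hp
    obtain ⟨c, rfl⟩ := hp
    have h : (1 : Qbar) ∈ invariantModule α := Submodule.subset_span (Set.mem_insert _ _)
    simpa using (invariantModule α).smul_mem c h
  | succ m ih =>
    intro p hp hmul
    have h1 : α ^ (algDegree α - (m + 1)) ∈ powerModule α :=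
      Submodule.subset_span ⟨_, by simp only [Set.mem_Iio]; omega, rfl⟩
    obtain ⟨q, hq, hq'⟩ := mem_powerModule.mp (hmul _ h1)
    have hz : aeval α (p * X ^ (algDegree α - (m + 1)) - q) = 0 := by simp [hq']
    obtain ⟨s, hs⟩ := primMinpoly_dvd hz
    have hf0 : primMinpoly α ≠ 0 := (primMinpoly_spec α).2.1.ne_zero
    have hcoe : p.coeff (m + 1) = (primMinpoly α).coeff (algDegree α) * s.coeff 0 := by
      have e1 : (p * X ^ (algDegree α - (m + 1)) - q).coeff (algDegree α) = p.coeff (m + 1) := by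
        rw [coeff_sub, coeff_mul_X_pow', if_pos (by omega), coeff_eq_zero_of_natDegree_lt hq,
          sub_zero]
        congr 1
        omega
      have hle : (p * X ^ (algDegree α - (m + 1)) - q).natDegree ≤ algDegree α := by
        refine (natDegree_sub_le _ _).trans (max_le (natDegree_mul_le.trans ?_) hq.le)
        rw [natDegree_X_pow]
        omega
      have hs0 : s.natDegree = 0 := by
        by_cases hs' : s = 0
        · simp [hs']
        · rw [hs, natDegree_mul hf0 hs'] at hle
          change algDegree α + _ ≤ _ at hle
          omega
      rw [← e1, hs, eq_C_of_natDegree_eq_zero hs0]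
      simp
    have hb : orderBasis α (m + 1) ∈ invariantModule α :=
      Submodule.subset_span (Set.mem_insert_of_mem _ ⟨m + 1, ⟨by omega, hm⟩, rfl⟩)
    have hsub : aeval α (p - s.coeff 0 • orderBasisPoly α (m + 1)) ∈ invariantModule α := by
      refine ih (by omega) _ ?_ ?_
      · rw [natDegree_le_iff_coeff_eq_zero]
        intro i hi
        rw [coeff_sub, coeff_smul, coeff_orderBasisPoly α hm]
        by_cases him : i = m + 1
        · subst him
          rw [if_pos (by omega), hcoe, Nat.sub_add_cancel hm.le, smul_eq_mul, mul_comm, sub_self]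
        · rw [if_neg (by omega), smul_zero, sub_zero]
          exact coeff_eq_zero_of_natDegree_lt (by omega)
      · intro y hy
        rw [map_sub, sub_mul, map_smul, aeval_orderBasisPoly, smul_mul_assoc]
        refine Submodule.sub_mem _ (hmul y hy) (Submodule.smul_mem _ _ ?_)
        induction hy using Submodule.span_induction with
        | mem x h =>
          obtain ⟨j, hj, rfl⟩ := h
          exact orderBasis_mul_pow_mem α hm hj
        | zero => simp
        | add x y _ _ hx hy => rw [mul_add]; exact Submodule.add_mem _ hx hy
        | smul c x _ hx => rw [mul_smul_comm]; exact Submodule.smul_mem _ _ hx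
    rw [map_sub, map_smul, aeval_orderBasisPoly] at hsub
    have := Submodule.add_mem _ hsub (Submodule.smul_mem _ (s.coeff 0) hb)
    simpa using this

/-- `invariantModule α` is the ring of multipliers of the module generated by
`1, α, …, α ^ (n - 1)`. -/
theorem mem_invariantModule_iff {α x : Qbar} :
    x ∈ invariantModule α ↔ ∀ y ∈ powerModule α, x * y ∈ powerModule α := by
  constructor
  · intro hx y hy
    induction hx using Submodule.span_induction with
    | mem x h =>
      rcases h with rfl | ⟨k, hk, rfl⟩
      · rwa [one_mul]
      · induction hy using Submodule.span_induction with
        | mem x h =>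
          obtain ⟨j, hj, rfl⟩ := h
          exact orderBasis_mul_pow_mem α hk.2 hj
        | zero => simp
        | add x y _ _ hx hy => rw [mul_add]; exact Submodule.add_mem _ hx hy
        | smul c x _ hx => rw [mul_smul_comm]; exact Submodule.smul_mem _ _ hx
    | zero => simp
    | add x y _ _ hx hy => rw [add_mul]; exact Submodule.add_mem _ hx hy
    | smul c x _ hx => rw [smul_mul_assoc]; exact Submodule.smul_mem _ _ hx
  · intro h
    have h1 : (1 : Qbar) ∈ powerModule α :=
      Submodule.subset_span ⟨0, algDegree_pos α, by simp⟩
    obtain ⟨p, hp, hpx⟩ := mem_powerModule.mp (h 1 h1)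
    rw [mul_one] at hpx
    subst hpx
    exact mem_invariantModule_of_natDegree_le α _ hp p le_rfl h

/-- The invariant order `ℤ_α`: the ring whose underlying `ℤ`-module is generated by
`1, a₀ α, a₀ α ^ 2 + a₁ α, …, a₀ α ^ (n - 1) + ⋯ + a₍ₙ₋₂₎ α`. -/
noncomputable def invariantOrder (α : Qbar) : Subring Qbar where
  carrier := invariantModule α
  one_mem' := Submodule.subset_span (Set.mem_insert _ _)
  zero_mem' := Submodule.zero_mem _
  add_mem' := Submodule.add_mem _
  neg_mem' := Submodule.neg_mem _
  mul_mem' := by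
    intro a b ha hb
    simp only [SetLike.mem_coe, mem_invariantModule_iff] at ha hb ⊢
    intro y hy
    rw [mul_assoc]
    exact ha _ (hb y hy)

/-- The invariant ideal `I_α = ℤ_α + α ℤ_α`, the `ℤ_α`-module generated by `1` and `α`. -/
noncomputable def invariantIdeal (α : Qbar) : Submodule (invariantOrder α) Qbar :=
  Submodule.span (invariantOrder α) {1, α}

/-! ## Ideal classes of a subring of a field -/

/-- Let `O` be a subring of a field `L`. A subset `I` of `L` lies in the ideal class `c` of `O` if
it is (the image in `L` of) an invertible fractional ideal of `O` in the fraction field of `O`,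
and the class of this fractional ideal is `c`. -/
def LiesInIdealClass {L : Type*} [Field L] (O : Subring L) (c : ClassGroup O) (I : Set L) : Prop :=
  ∃ J : (FractionalIdeal (nonZeroDivisors O) (FractionRing O))ˣ,
    ClassGroup.mk (FractionRing O) J = c ∧
    IsFractionRing.lift (K := FractionRing O) O.subtype_injective ''
      {x | x ∈ (J : FractionalIdeal (nonZeroDivisors O) (FractionRing O))} = I

/-!
Write `M_α` for the `ℤ`-module generated by `1, α, …, α ^ (n - 1)`, where `n` is the degree of `α`.
Both conditions of the theorem are compared with the condition that `M_β = l M_α` for some nonzero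
`l` and some roots `α` of `f` and `β` of `g`.

*Hermite equivalence.* Up to constants, the linear factors of `[f]` and `[g]` have as coefficients
the bases of the conjugates of `M_α` and `M_β`. If `[g](X) = ± [f](U X)`, unique factorisation makes
a factor of `[g]` proportional to a factor of `[f](U X)`, which says that `M_β = l M_α`
(`HermiteEquivalent.exists_powerModule_eq`). Conversely, `M_β = l M_α` gives `U ∈ GLₙ(ℤ)` matching
one factor, hence all their conjugates, and `[g]` is a constant times `[f](U X)`
(`hermiteEquivalent_of_powerModule_eq`). The constant is `± 1` because `ℤ_α`, the ring of
multipliers of `M_α`, is also that of `M_β`, and the determinant of the basis of `ℤ_α`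
relative to the powers of `α` is `a₀ ^ (n - 1)` (`prod_conjugates_eq`).

*Ideal classes.* As `M_α = I_α ^ (n - 1)` (`idealModule_pow`), equality of orders and of ideal
classes gives `M_β = m ^ (n - 1) M_α`. The converse needs more, since it is the class of `I_α` and
not that of its `(n - 1)`-th power that is to be found. Let `J_α` be the module generated by the
coefficients of `(a₀ X ^ n + ⋯ + aₙ) / (X - α)`. By primitivity `I_α J_α = ℤ_α`
(`idealModule_mul_inverseModule`), so `J_α` is the inverse of `I_α`. It is also dual to `M_α`, by an
identity of Euler; hence `M_β = l M_α` forces `J_β` to be a multiple of `J_α`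
(`exists_sum_cofactor_eq`), and then `I_β` is a multiple of `I_α` (`exists_idealModule_eq`).

In the monic case `M_α = ℤ[α]` is a ring, so it is equal to its ring of multipliers `ℤ_α`.
-/

/-! ### Conjugates of an algebraic number -/

theorem eq_or_eq_neg_primMinpoly {f : ℤ[X]} (hf : Irreducible f) {α : Qbar}
    (h : aeval α f = 0) : f = primMinpoly α ∨ f = -primMinpoly α := by
  obtain ⟨u, hu⟩ := (primMinpoly_spec α).2.1.associated_of_dvd hf (primMinpoly_dvd h)
  obtain ⟨r, hr, hur⟩ := Polynomial.isUnit_iff.1 u.isUnit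
  rw [← hu, ← hur]
  rcases Int.isUnit_iff.1 hr with rfl | rfl
  · left; simp
  · right; simp

theorem map_primMinpoly_irreducible (α : Qbar) :
    Irreducible ((primMinpoly α).map (algebraMap ℤ ℚ)) :=
  ((primMinpoly_spec α).1.irreducible_iff_irreducible_map_fraction_map (K := ℚ)).mp
    (primMinpoly_spec α).2.1

theorem exists_ringHom_of_aeval_eq_zero {α a : Qbar} (h : aeval a (primMinpoly α) = 0) :
    ∃ σ : Qbar →+* Qbar, σ α = a := by
  have halg : ∀ x : Qbar, IsAlgebraic ℚ x := isAlgebraic_rat_Qbar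
  have : Algebra.IsAlgebraic ℚ Qbar := ⟨halg⟩
  have : IsAlgClosure ℚ Qbar := ⟨inferInstance, inferInstance⟩
  have : Normal ℚ Qbar := IsAlgClosure.normal ℚ Qbar
  have hz : aeval a (minpoly ℚ α) = 0 := by
    have h1 : minpoly ℚ α ∣ (primMinpoly α).map (algebraMap ℤ ℚ) :=
      minpoly.dvd ℚ α (by rw [aeval_map_algebraMap]; exact (primMinpoly_spec α).2.2.2)
    have h2 := (minpoly.irreducible (halg α).isIntegral).associated_of_dvd
      (map_primMinpoly_irreducible α) h1
    have h3 : aeval a ((primMinpoly α).map (algebraMap ℤ ℚ)) = 0 := by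
      rw [aeval_map_algebraMap]; exact h
    obtain ⟨q, hq⟩ := h2.symm.dvd
    rw [hq, map_mul, h3, zero_mul]
  obtain ⟨σ, hσ⟩ := minpoly.exists_algEquiv_of_root' (halg α) hz
  exact ⟨(σ : Qbar →+* Qbar), hσ⟩

theorem aeval_ringHom (σ : Qbar →+* Qbar) (α : Qbar) (p : ℤ[X]) :
    aeval (σ α) p = σ (aeval α p) := by
  rw [aeval_def, aeval_def, hom_eval₂]
  congr 1
  exact RingHom.ext_int _ _

theorem card_aroots_primMinpoly (α : Qbar) :
    Multiset.card ((primMinpoly α).aroots Qbar) = algDegree α := by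
  rw [aroots, IsAlgClosed.card_roots_eq_natDegree,
    natDegree_map_eq_of_injective (algebraMap ℤ Qbar).injective_int, algDegree]

theorem nodup_aroots_primMinpoly (α : Qbar) : ((primMinpoly α).aroots Qbar).Nodup := by
  have h := (nodup_aroots_iff_of_splits (K := Qbar) (map_primMinpoly_irreducible α).ne_zero
    (IsAlgClosed.splits _)).2 (map_primMinpoly_irreducible α).separable
  rwa [aroots, map_map, ← IsScalarTower.algebraMap_eq] at h

/-- The roots of `primMinpoly α` are the images of `α` under `n` field embeddings. -/
theorem exists_conjugates (α : Qbar) : ∃ σ : Fin (algDegree α) → Qbar →+* Qbar,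
    Function.Injective (fun i => σ i α) ∧
    (primMinpoly α).aroots Qbar = Finset.univ.val.map fun i => σ i α := by
  have key : ∀ (m : Multiset Qbar) (n : ℕ), Multiset.card m = n →
      ∃ v : Fin n → Qbar, m = Finset.univ.val.map v := by
    intro m n h
    obtain ⟨l, rfl⟩ : ∃ l : List Qbar, (l : Multiset Qbar) = m := Quotient.exists_rep m
    rw [Multiset.coe_card] at h
    subst h
    exact ⟨l.get, by rw [Fin.univ_val_map, List.ofFn_get]⟩
  obtain ⟨v, hv⟩ := key _ _ (card_aroots_primMinpoly α)
  have hσ : ∀ i, ∃ σ : Qbar →+* Qbar, σ α = v i := fun i => by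
    refine exists_ringHom_of_aeval_eq_zero ?_
    have : v i ∈ (primMinpoly α).aroots Qbar := by rw [hv]; simp
    exact (mem_aroots.1 this).2
  choose σ hσ using hσ
  have hnd := nodup_aroots_primMinpoly α
  refine ⟨σ, ?_, by simp only [hσ, hv]⟩
  simp only [hσ]
  rw [hv] at hnd
  exact fun i j hij => Multiset.inj_on_of_nodup_map hnd i (by simp) j (by simp) hij

/-! ### Integral bases of the modules attached to an algebraic number -/

/-- Two `ℤ`-bases of the same lattice are related by a matrix in `GLₙ(ℤ)`. -/
theorem exists_GL_of_span_eq {n : ℕ} {v w : Fin n → Qbar} (hv : LinearIndependent ℤ v)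
    (hw : LinearIndependent ℤ w)
    (h : Submodule.span ℤ (Set.range v) = Submodule.span ℤ (Set.range w)) :
    ∃ U : Matrix.GeneralLinearGroup (Fin n) ℤ, ∀ j, w j = ∑ i, U.val i j • v i := by
  have h1 : ∀ j, ∃ c : Fin n → ℤ, ∑ i, c i • v i = w j := fun j =>
    (Submodule.mem_span_range_iff_exists_fun ℤ).1 (h ▸ Submodule.subset_span ⟨j, rfl⟩)
  have h2 : ∀ j, ∃ c : Fin n → ℤ, ∑ i, c i • w i = v j := fun j =>
    (Submodule.mem_span_range_iff_exists_fun ℤ).1 (h ▸ Submodule.subset_span ⟨j, rfl⟩)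
  choose a ha using h1
  choose b hb using h2
  -- Expanding `v` in terms of `w` and back shows that the two matrices are inverse.
  have key : ∀ {v w : Fin n → Qbar} (a b : Fin n → Fin n → ℤ), LinearIndependent ℤ v →
      (∀ j, ∑ i, a j i • v i = w j) → (∀ j, ∑ i, b j i • w i = v j) →
      (Matrix.of fun i j => a j i) * (Matrix.of fun i j => b j i) = 1 := by
    intro v w a b hv ha hb
    ext i j
    have h3 : ∑ k, ((∑ l, a l k * b j l) - (if k = j then 1 else 0)) • v k = 0 := by
      simp only [sub_smul, Finset.sum_sub_distrib, ite_smul, one_smul, zero_smul,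
        Finset.sum_ite_eq', Finset.mem_univ, if_true, sub_eq_zero]
      conv_rhs => rw [← hb j]
      simp only [← ha, Finset.sum_smul, Finset.smul_sum, smul_smul]
      rw [Finset.sum_comm]
      simp only [mul_comm]
    have h4 := Fintype.linearIndependent_iff.1 hv _ h3 i
    rw [Matrix.mul_apply, Matrix.one_apply]
    simpa [sub_eq_zero] using h4
  exact ⟨⟨_, _, key a b hv ha hb, key b a hw hb ha⟩, fun j => (ha j).symm⟩

theorem card_eq_of_span_eq {n m : ℕ} {v : Fin n → Qbar} {w : Fin m → Qbar}
    (hv : LinearIndependent ℤ v) (hw : LinearIndependent ℤ w)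
    (h : Submodule.span ℤ (Set.range v) = Submodule.span ℤ (Set.range w)) : n = m := by
  have h1 := finrank_span_eq_card hv
  have h2 := finrank_span_eq_card hw
  rw [h] at h1
  simpa using h1.symm.trans h2

theorem linearIndependent_pow_algDegree (α : Qbar) :
    LinearIndependent ℤ (fun i : Fin (algDegree α) => α ^ (i : ℕ)) := by
  rw [Fintype.linearIndependent_iff]
  intro g hg i
  set p : ℤ[X] := ∑ j : Fin (algDegree α), C (g j) * X ^ (j : ℕ) with hp
  have hp0 : aeval α p = 0 := by
    rw [← hg, hp]; simp
  have hdeg : p.degree < (primMinpoly α).degree := by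
    rw [degree_eq_natDegree (primMinpoly_spec α).2.1.ne_zero]
    refine (Polynomial.degree_sum_le _ _).trans_lt ?_
    rw [Finset.sup_lt_iff (WithBot.bot_lt_coe _)]
    intro j _
    exact (degree_C_mul_X_pow_le _ _).trans_lt (by exact_mod_cast j.2)
  have hpz : p = 0 := Polynomial.eq_zero_of_dvd_of_degree_lt (primMinpoly_dvd hp0) hdeg
  have := congrArg (fun q => q.coeff (i : ℕ)) hpz
  simpa [hp, finsetSum_coeff, coeff_X_pow, Fin.val_inj] using this

theorem powerModule_eq_span_range (α : Qbar) : powerModule α =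
    Submodule.span ℤ (Set.range fun i : Fin (algDegree α) => α ^ (i : ℕ)) := by
  rw [powerModule]
  congr 1
  ext x
  simp only [Set.mem_image, Set.mem_Iio, Set.mem_range]
  exact ⟨fun ⟨i, hi, h⟩ => ⟨⟨i, hi⟩, h⟩, fun ⟨i, h⟩ => ⟨i, i.2, h⟩⟩

/-- The `ℤ`-basis `1, a₀ α, a₀ α ^ 2 + a₁ α, …` of the invariant order. -/
noncomputable def orderVec (α : Qbar) (k : Fin (algDegree α)) : Qbar :=
  if (k : ℕ) = 0 then 1 else orderBasis α k

theorem invariantModule_eq_span_range (α : Qbar) :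
    invariantModule α = Submodule.span ℤ (Set.range (orderVec α)) := by
  rw [invariantModule]
  congr 1
  ext x
  simp only [Set.mem_insert_iff, Set.mem_image, Set.mem_Ico, Set.mem_range, orderVec]
  constructor
  · rintro (rfl | ⟨k, hk, rfl⟩)
    · exact ⟨⟨0, algDegree_pos α⟩, by simp⟩
    · exact ⟨⟨k, hk.2⟩, if_neg (by simp; omega)⟩
  · rintro ⟨k, rfl⟩
    by_cases hk : (k : ℕ) = 0
    · simp [hk]
    · exact Or.inr ⟨k, ⟨by omega, k.2⟩, by simp [hk]⟩

/-- The matrix expressing `orderVec α` in terms of the powers of `α`. -/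
noncomputable def orderMatrix (α : Qbar) : Matrix (Fin (algDegree α)) (Fin (algDegree α)) ℤ :=
  Matrix.of fun i k => (if (k : ℕ) = 0 then (1 : ℤ[X]) else orderBasisPoly α k).coeff i

theorem orderVec_eq_sum (α : Qbar) (k : Fin (algDegree α)) :
    orderVec α k = ∑ i : Fin (algDegree α), orderMatrix α i k • α ^ (i : ℕ) := by
  have h : orderVec α k =
      aeval α (if (k : ℕ) = 0 then (1 : ℤ[X]) else orderBasisPoly α k) := by
    rw [orderVec]; split_ifs <;> simp [aeval_orderBasisPoly]
  have hd : (if (k : ℕ) = 0 then (1 : ℤ[X]) else orderBasisPoly α k).natDegree < algDegree α := by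
    split_ifs with hk
    · simpa using algDegree_pos α
    · rw [Nat.lt_iff_le_pred (algDegree_pos α), natDegree_le_iff_coeff_eq_zero]
      intro m hm
      rw [coeff_orderBasisPoly α k.2, if_neg (by omega)]
  rw [h, aeval_eq_sum_range' hd, Finset.sum_range]
  rfl

theorem det_orderMatrix (α : Qbar) :
    (orderMatrix α).det = (primMinpoly α).leadingCoeff ^ (algDegree α - 1) := by
  rw [Matrix.det_of_isUpperTriangular]
  · have : ∀ i : Fin (algDegree α), orderMatrix α i i =
        if (i : ℕ) = 0 then 1 else (primMinpoly α).leadingCoeff := by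
      intro i
      simp only [orderMatrix, Matrix.of_apply]
      split_ifs with h
      · simp [h]
      · rw [coeff_orderBasisPoly α i.2, if_pos (by omega), Nat.sub_add_cancel i.2.le]
        rfl
    simp only [this]
    rw [Fin.prod_univ_eq_prod_range
      (fun i : ℕ => if i = 0 then (1 : ℤ) else (primMinpoly α).leadingCoeff)]
    obtain ⟨m, hm⟩ := Nat.exists_eq_succ_of_ne_zero (algDegree_pos α).ne'
    rw [hm, Nat.succ_eq_add_one, Finset.prod_range_succ']
    simp
  · intro i k hik
    have hik : k < i := hik
    have hik' : (k : ℕ) < i := hik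
    simp only [orderMatrix, Matrix.of_apply]
    split_ifs with h
    · rw [coeff_one, if_neg (by omega)]
    · rw [coeff_orderBasisPoly α k.2, if_neg (by omega)]

theorem linearIndependent_orderVec (α : Qbar) : LinearIndependent ℤ (orderVec α) := by
  rw [Fintype.linearIndependent_iff]
  intro g hg
  have h1 : ∑ i : Fin (algDegree α), ((orderMatrix α).mulVec g) i • α ^ (i : ℕ) = 0 := by
    rw [← hg]
    simp only [orderVec_eq_sum, Matrix.mulVec, dotProduct, Finset.sum_smul, Finset.smul_sum,
      smul_smul]
    rw [Finset.sum_comm]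
    simp only [mul_comm]
  have h2 := Fintype.linearIndependent_iff.1 (linearIndependent_pow_algDegree α) _ h1
  have h3 : g = 0 := Matrix.eq_zero_of_mulVec_eq_zero (by
    rw [det_orderMatrix]
    exact pow_ne_zero _ (primMinpoly_spec α).2.2.1.ne') (funext h2)
  exact congrFun h3

theorem algDegree_eq_of_invariantModule_eq {α β : Qbar}
    (h : invariantModule α = invariantModule β) : algDegree α = algDegree β :=
  card_eq_of_span_eq (linearIndependent_orderVec α) (linearIndependent_orderVec β)
    (by rw [← invariantModule_eq_span_range, ← invariantModule_eq_span_range, h])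

/-! ### The invariant ideal and the module of powers -/

theorem span_range_eq_of_GL {n : ℕ} {v w : Fin n → Qbar}
    (U : Matrix.GeneralLinearGroup (Fin n) ℤ) (h : ∀ j, w j = ∑ i, U.val i j • v i) :
    Submodule.span ℤ (Set.range w) = Submodule.span ℤ (Set.range v) := by
  have le : ∀ {v w : Fin n → Qbar} (A : Matrix (Fin n) (Fin n) ℤ),
      (∀ j, w j = ∑ i, A i j • v i) →
      Submodule.span ℤ (Set.range w) ≤ Submodule.span ℤ (Set.range v) := by
    intro v w A h
    rw [Submodule.span_le]
    rintro _ ⟨j, rfl⟩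
    rw [h j]
    exact Submodule.sum_mem _ fun i _ =>
      Submodule.smul_mem _ _ (Submodule.subset_span ⟨i, rfl⟩)
  refine le_antisymm (le _ h) (le U.inv fun j => ?_)
  have h1 : U.val * U.inv = 1 := U.val_inv
  simp only [h, Finset.smul_sum, smul_smul]
  rw [Finset.sum_comm]
  have h2 : ∀ i, ∑ k, (U.inv k j * U.val i k) • v i = (if i = j then (1 : ℤ) else 0) • v i := by
    intro i
    rw [← Finset.sum_smul, ← Matrix.one_apply, ← h1, Matrix.mul_apply]
    simp only [mul_comm]
  simp only [h2, ite_smul, one_smul, zero_smul, Finset.sum_ite_eq', Finset.mem_univ, if_true]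

theorem span_singleton_mul_span_range {ι : Type*} (c : Qbar) (v : ι → Qbar) :
    Submodule.span ℤ {c} * Submodule.span ℤ (Set.range v) =
      Submodule.span ℤ (Set.range fun i => c * v i) := by
  rw [Submodule.span_mul_span, Set.singleton_mul, ← Set.range_comp]
  rfl

theorem span_singleton_mul_span_inv {c : Qbar} (hc : c ≠ 0) :
    Submodule.span ℤ {c} * Submodule.span ℤ {c⁻¹} = 1 := by
  rw [Submodule.span_mul_span, Set.singleton_mul_singleton, mul_inv_cancel₀ hc,
    Submodule.one_eq_span]

theorem powerModule_eq_span_range_of_algDegree_eq {α : Qbar} {n : ℕ} (h : algDegree α = n) :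
    powerModule α = Submodule.span ℤ (Set.range fun i : Fin n => α ^ (i : ℕ)) := by
  subst h; exact powerModule_eq_span_range α

theorem linearIndependent_mul_pow {α l : Qbar} {n : ℕ} (hα : algDegree α = n) (hl : l ≠ 0) :
    LinearIndependent ℤ fun i : Fin n => l * α ^ (i : ℕ) := by
  subst hα
  exact (linearIndependent_pow_algDegree α).map' (LinearMap.mulLeft ℤ l)
    (LinearMap.ker_eq_bot.2 (mul_right_injective₀ hl))

theorem algDegree_eq_of_powerModule_eq {α β l : Qbar} (hl : l ≠ 0)
    (h : powerModule β = Submodule.span ℤ {l} * powerModule α) : algDegree α = algDegree β := by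
  rw [powerModule_eq_span_range, powerModule_eq_span_range α, span_singleton_mul_span_range] at h
  exact card_eq_of_span_eq (linearIndependent_mul_pow rfl hl)
    (linearIndependent_pow_algDegree β) h.symm

theorem exists_GL_of_powerModule_eq {α β l : Qbar} {n : ℕ} (hα : algDegree α = n)
    (hβ : algDegree β = n) (hl : l ≠ 0)
    (h : powerModule β = Submodule.span ℤ {l} * powerModule α) :
    ∃ U : Matrix.GeneralLinearGroup (Fin n) ℤ,
      ∀ j : Fin n, β ^ (j : ℕ) = l * ∑ i : Fin n, U.val i j • α ^ (i : ℕ) := by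
  rw [powerModule_eq_span_range_of_algDegree_eq hα, powerModule_eq_span_range_of_algDegree_eq hβ,
    span_singleton_mul_span_range] at h
  have hi : LinearIndependent ℤ fun i : Fin n => β ^ (i : ℕ) := by
    subst hβ; exact linearIndependent_pow_algDegree β
  obtain ⟨U, hU⟩ := exists_GL_of_span_eq (linearIndependent_mul_pow hα hl) hi h.symm
  refine ⟨U, fun j => ?_⟩
  rw [hU, Finset.mul_sum]
  simp only [mul_smul_comm]

theorem one_mem_invariantModule (α : Qbar) : (1 : Qbar) ∈ invariantModule α :=
  Submodule.subset_span (Set.mem_insert _ _)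

theorem intCast_mem_invariantModule (α : Qbar) (z : ℤ) : (z : Qbar) ∈ invariantModule α := by
  simpa using (invariantModule α).smul_mem z (one_mem_invariantModule α)

theorem invariantModule_mul_powerModule (α : Qbar) :
    invariantModule α * powerModule α = powerModule α := by
  refine le_antisymm (Submodule.mul_le.2 fun x hx y hy => mem_invariantModule_iff.1 hx y hy) ?_
  calc powerModule α = 1 * powerModule α := (one_mul _).symm
    _ ≤ _ := mul_le_mul_left (Submodule.one_le.2 (one_mem_invariantModule α)) _

theorem invariantModule_mul_self (α : Qbar) :
    invariantModule α * invariantModule α = invariantModule α := by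
  refine le_antisymm (Submodule.mul_le.2 fun x hx y hy => (invariantOrder α).mul_mem hx hy) ?_
  calc invariantModule α = 1 * invariantModule α := (one_mul _).symm
    _ ≤ _ := mul_le_mul_left (Submodule.one_le.2 (one_mem_invariantModule α)) _

theorem invariantModule_le_powerModule (α : Qbar) : invariantModule α ≤ powerModule α := by
  intro x hx
  have h1 : (1 : Qbar) ∈ powerModule α := Submodule.subset_span ⟨0, algDegree_pos α, by simp⟩
  simpa using mem_invariantModule_iff.1 hx 1 h1

theorem invariantModule_eq_of_powerModule_eq {α β l : Qbar} (hl : l ≠ 0)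
    (h : powerModule β = Submodule.span ℤ {l} * powerModule α) :
    invariantModule α = invariantModule β := by
  ext x
  rw [mem_invariantModule_iff, mem_invariantModule_iff, h]
  simp only [Submodule.mem_span_singleton_mul]
  constructor
  · rintro hx _ ⟨z, hz, rfl⟩
    exact ⟨x * z, hx z hz, by ring⟩
  · intro hx y hy
    obtain ⟨z, hz, hz'⟩ := hx _ ⟨y, hy, rfl⟩
    have : z = x * y := mul_left_cancel₀ hl (by rw [hz']; ring)
    rwa [← this]

/-- The invariant ideal, as a `ℤ`-module. -/
noncomputable def idealModule (α : Qbar) : Submodule ℤ Qbar :=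
  invariantModule α * Submodule.span ℤ {1, α}

theorem span_one_self_pow (α : Qbar) (k : ℕ) : (Submodule.span ℤ {1, α} : Submodule ℤ Qbar) ^ k =
    Submodule.span ℤ ((fun i : ℕ => α ^ i) '' Set.Iio (k + 1)) := by
  induction k with
  | zero => simp [Submodule.one_eq_span]
  | succ k ih =>
    rw [pow_succ, ih, Submodule.span_mul_span]
    refine le_antisymm (Submodule.span_le.2 ?_) (Submodule.span_mono ?_)
    · rintro _ ⟨_, ⟨i, hi, rfl⟩, y, hy, rfl⟩
      simp only [Set.mem_Iio] at hi
      rcases hy with rfl | rfl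
      · exact Submodule.subset_span ⟨i, by simp only [Set.mem_Iio]; omega, by simp⟩
      · exact Submodule.subset_span ⟨i + 1, by simp only [Set.mem_Iio]; omega, by simp [pow_succ]⟩
    · rintro _ ⟨i, hi, rfl⟩
      simp only [Set.mem_Iio] at hi
      rcases i with _ | i
      · exact ⟨1, ⟨0, by simp, by simp⟩, 1, by simp, by simp⟩
      · exact ⟨α ^ i, ⟨i, by simp only [Set.mem_Iio]; omega, rfl⟩, α, by simp, by simp [pow_succ]⟩

/-- `M_α = I_α ^ (n - 1)`; for `n = 1` both sides are `ℤ`. -/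
theorem idealModule_pow (α : Qbar) : idealModule α ^ (algDegree α - 1) = powerModule α := by
  have h1 : (Submodule.span ℤ {1, α} : Submodule ℤ Qbar) ^ (algDegree α - 1) = powerModule α := by
    rw [span_one_self_pow, Nat.sub_add_cancel (algDegree_pos α), powerModule]
  have h2 : ∀ k, invariantModule α ^ k * powerModule α = powerModule α := by
    intro k
    induction k with
    | zero => simp
    | succ k ih => rw [pow_succ, mul_assoc, invariantModule_mul_powerModule, ih]
  rw [idealModule, mul_pow, h1, h2]

theorem powerModule_eq_of_idealModule_eq {α β m : Qbar}
    (hO : invariantModule α = invariantModule β)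
    (hI : idealModule β = Submodule.span ℤ {m} * idealModule α) :
    powerModule β = Submodule.span ℤ {m ^ (algDegree α - 1)} * powerModule α := by
  rw [← idealModule_pow, ← idealModule_pow, ← algDegree_eq_of_invariantModule_eq hO, hI, mul_pow,
    Submodule.span_pow, Set.singleton_pow]

/-! ### The inverse of the invariant ideal -/

/-- The coefficients of the polynomial `(a₀ X ^ n + ⋯ + aₙ) / (X - α)`. -/
noncomputable def cofactor (α : Qbar) (k : ℕ) : Qbar :=
  ((primMinpoly α).map (algebraMap ℤ Qbar) /ₘ (X - C α)).coeff k

theorem cofactor_rec (α : Qbar) (k : ℕ) :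
    cofactor α k = ((primMinpoly α).coeff (k + 1) : Qbar) + α * cofactor α (k + 1) := by
  rw [cofactor, coeff_divByMonic_X_sub_C_rec, coeff_map]
  rfl

theorem isRoot_map_primMinpoly (α : Qbar) :
    ((primMinpoly α).map (algebraMap ℤ Qbar)).IsRoot α := by
  rw [IsRoot.def, eval_map_algebraMap]
  exact (primMinpoly_spec α).2.2.2

theorem X_sub_C_mul_divByMonic (α : Qbar) : (X - C α) *
    ((primMinpoly α).map (algebraMap ℤ Qbar) /ₘ (X - C α)) =
      (primMinpoly α).map (algebraMap ℤ Qbar) :=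
  mul_divByMonic_eq_iff_isRoot.2 (isRoot_map_primMinpoly α)

theorem coeff_zero_eq_cofactor (α : Qbar) :
    ((primMinpoly α).coeff 0 : Qbar) = -(α * cofactor α 0) := by
  have h := congrArg (fun p => p.coeff 0) (X_sub_C_mul_divByMonic α)
  simp only [mul_coeff_zero, coeff_sub, coeff_X_zero, coeff_C_zero, coeff_map, zero_sub] at h
  rw [cofactor, ← neg_mul, h]
  rfl

theorem natDegree_map_primMinpoly (α : Qbar) :
    ((primMinpoly α).map (algebraMap ℤ Qbar)).natDegree = algDegree α :=
  natDegree_map_eq_of_injective (algebraMap ℤ Qbar).injective_int _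

theorem cofactor_eq_zero (α : Qbar) {k : ℕ} (hk : algDegree α ≤ k) : cofactor α k = 0 := by
  refine coeff_eq_zero_of_natDegree_lt ?_
  rw [natDegree_divByMonic _ (monic_X_sub_C α), natDegree_map_primMinpoly, natDegree_X_sub_C]
  have := algDegree_pos α
  omega

theorem cofactor_eq_orderBasis_add (α : Qbar) (m : ℕ) (hm : m < algDegree α) :
    cofactor α (algDegree α - 1 - m) =
      orderBasis α m + ((primMinpoly α).coeff (algDegree α - m) : Qbar) := by
  induction m with
  | zero =>
    rw [cofactor_rec, cofactor_eq_zero α (by omega), Nat.sub_zero, Nat.sub_zero,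
      Nat.sub_add_cancel hm]
    simp [orderBasis]
  | succ m ih =>
    have h1 : orderBasis α (m + 1) =
        α * (orderBasis α m + ((primMinpoly α).coeff (algDegree α - m) : Qbar)) := by
      simp only [orderBasis]
      rw [Finset.sum_range_succ, mul_add, Finset.mul_sum]
      congr 1
      · refine Finset.sum_congr rfl fun i hi => ?_
        simp only [Finset.mem_range] at hi
        rw [Nat.succ_sub hi.le, pow_succ]
        ring
      · simp; ring
    rw [cofactor_rec, h1, ← ih (by omega), add_comm]
    congr 3 <;> omega

theorem cofactor_mem_invariantModule (α : Qbar) (k : ℕ) : cofactor α k ∈ invariantModule α := by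
  by_cases hk : k < algDegree α
  · have h := cofactor_eq_orderBasis_add α (algDegree α - 1 - k) (by omega)
    rw [show algDegree α - 1 - (algDegree α - 1 - k) = k by omega] at h
    rw [h]
    refine Submodule.add_mem _ ?_ (intCast_mem_invariantModule α _)
    by_cases h0 : algDegree α - 1 - k = 0
    · simp [h0, orderBasis]
    · exact Submodule.subset_span (Set.mem_insert_of_mem _ ⟨_, ⟨by omega, by omega⟩, rfl⟩)
  · rw [cofactor_eq_zero α (by omega)]
    exact Submodule.zero_mem _

theorem mul_cofactor_mem_invariantModule (α : Qbar) (k : ℕ) :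
    α * cofactor α k ∈ invariantModule α := by
  rcases k with _ | k
  · rw [← neg_eq_iff_eq_neg.2 (coeff_zero_eq_cofactor α)]
    exact Submodule.neg_mem _ (intCast_mem_invariantModule α _)
  · rw [← sub_eq_iff_eq_add'.2 (cofactor_rec α k)]
    exact Submodule.sub_mem _ (cofactor_mem_invariantModule α k) (intCast_mem_invariantModule α _)

/-- The inverse `J_α` of the invariant ideal: the `ℤ`-module generated by the coefficients of
`(a₀ X ^ n + ⋯ + aₙ) / (X - α)`. -/
noncomputable def inverseModule (α : Qbar) : Submodule ℤ Qbar :=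
  Submodule.span ℤ (Set.range (cofactor α))

theorem one_mem_span_mul_inverseModule (α : Qbar) :
    (1 : Qbar) ∈ Submodule.span ℤ {1, α} * inverseModule α := by
  set N := Submodule.span ℤ {1, α} * inverseModule α
  have h1 : ∀ k, cofactor α k ∈ N := fun k => by
    have h := Submodule.mul_mem_mul (Submodule.subset_span (s := {1, α}) (Or.inl rfl))
      (Submodule.subset_span ⟨k, rfl⟩ : cofactor α k ∈ inverseModule α)
    rwa [one_mul] at h
  have h2 : ∀ k, α * cofactor α k ∈ N := fun k =>
    Submodule.mul_mem_mul (Submodule.subset_span (s := {1, α}) (Or.inr rfl))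
      (Submodule.subset_span ⟨k, rfl⟩ : cofactor α k ∈ inverseModule α)
  have h3 : ∀ k, ((primMinpoly α).coeff k : Qbar) ∈ N := by
    intro k
    rcases k with _ | k
    · rw [coeff_zero_eq_cofactor]
      exact N.neg_mem (h2 0)
    · rw [← sub_eq_iff_eq_add.2 (cofactor_rec α k)]
      exact N.sub_mem (h1 k) (h2 _)
  -- The integers in `N` form an ideal of `ℤ`; its generator divides the content, so is a unit.
  let S : Ideal ℤ := N.comap (Algebra.linearMap ℤ Qbar)
  have hS : ∀ z : ℤ, z ∈ S ↔ (z : Qbar) ∈ N := fun z => Iff.rfl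
  obtain ⟨d, hd⟩ := (IsPrincipalIdealRing.principal S).principal
  have hdvd : C d ∣ primMinpoly α := by
    rw [C_dvd_iff_dvd_coeff]
    intro k
    have : (primMinpoly α).coeff k ∈ S := h3 k
    rw [hd] at this
    exact Ideal.mem_span_singleton.1 this
  have hu := (primMinpoly_spec α).1 d hdvd
  have : S = ⊤ := by
    rw [hd]; exact Ideal.span_singleton_eq_top.2 hu
  have h1S : (1 : ℤ) ∈ S := this ▸ trivial
  simpa using (hS 1).1 h1S

theorem idealModule_mul_inverseModule (α : Qbar) :
    idealModule α * inverseModule α = invariantModule α := by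
  rw [idealModule, mul_assoc]
  refine le_antisymm ?_ ?_
  · calc _ ≤ invariantModule α * invariantModule α := by
          refine mul_le_mul_right ?_ _
          rw [inverseModule, Submodule.span_mul_span, Submodule.span_le]
          rintro _ ⟨x, rfl | rfl, _, ⟨k, rfl⟩, rfl⟩
          · simpa using cofactor_mem_invariantModule α k
          · exact mul_cofactor_mem_invariantModule _ k
      _ = _ := invariantModule_mul_self α
  · calc invariantModule α = invariantModule α * 1 := (mul_one _).symm
      _ ≤ _ := mul_le_mul_right (Submodule.one_le.2 (one_mem_span_mul_inverseModule α)) _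

theorem invariantModule_mul_idealModule (α : Qbar) :
    invariantModule α * idealModule α = idealModule α := by
  rw [idealModule, ← mul_assoc, invariantModule_mul_self]

/-- Inverting a homothety between the inverses of the invariant ideals. -/
theorem idealModule_eq_of_inverseModule_eq {α β c : Qbar} (hc : c ≠ 0)
    (hO : invariantModule α = invariantModule β)
    (hJ : inverseModule β = Submodule.span ℤ {c} * inverseModule α) :
    idealModule β = Submodule.span ℤ {c⁻¹} * idealModule α := by
  have h1 : idealModule α = Submodule.span ℤ {c} * idealModule β := calc
    idealModule α = (idealModule β * inverseModule β) * idealModule α := by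
      rw [idealModule_mul_inverseModule, ← hO, invariantModule_mul_idealModule]
    _ = Submodule.span ℤ {c} * ((idealModule α * inverseModule α) * idealModule β) := by
      rw [hJ]; ring
    _ = _ := by rw [idealModule_mul_inverseModule, hO, invariantModule_mul_idealModule]
  rw [h1, ← mul_assoc, mul_comm (Submodule.span ℤ {c⁻¹}), span_singleton_mul_span_inv hc, one_mul]

/-! ### Homothetic modules of powers have equivalent invariant ideals -/

theorem leadingCoeff_eq_cofactor (α : Qbar) :
    ((primMinpoly α).leadingCoeff : Qbar) = cofactor α (algDegree α - 1) := by
  rw [cofactor_rec, cofactor_eq_zero α (by omega), Nat.sub_add_cancel (algDegree_pos α)]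
  simp [algDegree]

theorem leadingCoeff_cast_ne_zero (α : Qbar) : ((primMinpoly α).leadingCoeff : Qbar) ≠ 0 :=
  Int.cast_ne_zero.2 (primMinpoly_spec α).2.2.1.ne'

/-- For degree `1` this says that `a₀ α = -a₁` is an integer. -/
theorem leadingCoeff_mul_mem (α : Qbar) :
    ((primMinpoly α).leadingCoeff : Qbar) * α ∈ invariantModule α := by
  rw [leadingCoeff_eq_cofactor, mul_comm]
  exact mul_cofactor_mem_invariantModule _ _

/-- Two numbers with the same invariant order generate the same field, so an embedding is
determined on one of them by its value at the other. -/
theorem ringHom_eq_of_invariantModule_eq {α β : Qbar}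
    (hO : invariantModule α = invariantModule β) {σ τ : Qbar →+* Qbar} (h : σ β = τ β) :
    σ α = τ α := by
  have h1 := invariantModule_le_powerModule β (hO ▸ leadingCoeff_mul_mem α)
  obtain ⟨p, -, hp⟩ := mem_powerModule.1 h1
  have h2 := aeval_ringHom σ β p
  rw [h, aeval_ringHom, hp, map_mul, map_mul, map_intCast, map_intCast] at h2
  exact (mul_left_cancel₀ (leadingCoeff_cast_ne_zero α) h2).symm

theorem aeval_ringHom_primMinpoly (σ : Qbar →+* Qbar) (α : Qbar) :
    aeval (σ α) (primMinpoly α) = 0 := by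
  rw [aeval_ringHom, (primMinpoly_spec α).2.2.2, map_zero]

theorem ringHom_pow_eq {α β l : Qbar} {n : ℕ} {A : Matrix (Fin n) (Fin n) ℤ}
    (h : ∀ j : Fin n, β ^ (j : ℕ) = l * ∑ i : Fin n, A i j • α ^ (i : ℕ))
    (σ : Qbar →+* Qbar) (j : Fin n) :
    σ β ^ (j : ℕ) = σ l * ∑ i : Fin n, A i j • σ α ^ (i : ℕ) := by
  rw [← map_pow, h]
  simp [map_sum]

theorem eval_divByMonic_eq_sum (β x : Qbar) {n : ℕ} (hβ : algDegree β = n) :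
    ((primMinpoly β).map (algebraMap ℤ Qbar) /ₘ (X - C β)).eval x =
      ∑ j : Fin n, cofactor β j * x ^ (j : ℕ) := by
  rw [eval_eq_sum_range' (n := n), Finset.sum_range]
  · rfl
  · rw [natDegree_divByMonic _ (monic_X_sub_C β), natDegree_map_primMinpoly, natDegree_X_sub_C]
    have := algDegree_pos β
    omega

/-- A polynomial vanishing at all conjugates of `α` other than `α`, of degree less than the
degree of `α`, is a multiple of `(a₀ X ^ n + ⋯ + aₙ) / (X - α)`. -/
theorem exists_eq_C_mul_divByMonic {α : Qbar} {P : Qbar[X]} (hdeg : P.natDegree < algDegree α)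
    (h : ∀ a, aeval a (primMinpoly α) = 0 → a ≠ α → P.eval a = 0) :
    ∃ c : Qbar, P = C c * ((primMinpoly α).map (algebraMap ℤ Qbar) /ₘ (X - C α)) := by
  by_cases hP : P = 0
  · exact ⟨0, by simp [hP]⟩
  have hF : (primMinpoly α).map (algebraMap ℤ Qbar) ≠ 0 := by
    intro h0
    have := natDegree_map_primMinpoly α
    rw [h0, natDegree_zero] at this
    exact (algDegree_pos α).ne this
  have hdvd : (primMinpoly α).map (algebraMap ℤ Qbar) ∣ (X - C α) * P := by
    refine (IsAlgClosed.splits _).dvd_of_roots_le_roots hF ?_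
    refine (Multiset.le_iff_subset (nodup_aroots_primMinpoly α)).2 fun a ha => ?_
    rw [mem_roots (mul_ne_zero (X_sub_C_ne_zero α) hP), IsRoot.def, eval_mul]
    by_cases haα : a = α
    · simp [haα]
    · rw [h a (mem_aroots.1 ha).2 haα, mul_zero]
  rw [← X_sub_C_mul_divByMonic] at hdvd
  obtain ⟨q, hq⟩ := (mul_dvd_mul_iff_left (X_sub_C_ne_zero α)).1 hdvd
  have hG : ((primMinpoly α).map (algebraMap ℤ Qbar) /ₘ (X - C α)) ≠ 0 := by
    rintro h0
    rw [h0, zero_mul] at hq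
    exact hP hq
  have hq0 : q ≠ 0 := by
    rintro rfl
    rw [mul_zero] at hq
    exact hP hq
  rw [hq, natDegree_mul hG hq0, natDegree_divByMonic _ (monic_X_sub_C α),
    natDegree_map_primMinpoly, natDegree_X_sub_C] at hdeg
  refine ⟨q.coeff 0, ?_⟩
  rw [← eq_C_of_natDegree_eq_zero (by omega : q.natDegree = 0), mul_comm]
  exact hq

/-- The modules `inverseModule α` are dual to the modules of powers: a change of basis for the
latter transforms the former contragrediently. -/
theorem exists_sum_cofactor_eq {α β l : Qbar} {n : ℕ} (hα : algDegree α = n)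
    (hβ : algDegree β = n) (hO : invariantModule α = invariantModule β) (hl : l ≠ 0)
    {A : Matrix (Fin n) (Fin n) ℤ}
    (h : ∀ j : Fin n, β ^ (j : ℕ) = l * ∑ i : Fin n, A i j • α ^ (i : ℕ)) :
    ∃ c : Qbar, ∀ i : Fin n, ∑ j : Fin n, A i j • cofactor β j = c * cofactor α i := by
  set P : Qbar[X] := ∑ i : Fin n, C (∑ j : Fin n, A i j • cofactor β j) * X ^ (i : ℕ) with hP
  have hn : 0 < n := hα ▸ algDegree_pos α
  have hdeg : P.natDegree < algDegree α := by
    rw [hα, Nat.lt_iff_le_pred hn]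
    refine natDegree_sum_le_of_forall_le _ _ fun i _ => (natDegree_C_mul_X_pow_le _ _).trans ?_
    have := i.2
    omega
  have hroot : ∀ a, aeval a (primMinpoly α) = 0 → a ≠ α → P.eval a = 0 := by
    intro a ha haα
    obtain ⟨σ, rfl⟩ := exists_ringHom_of_aeval_eq_zero ha
    -- `P (σ α)` is, up to the factor `σ l`, the value at `σ β` of the quotient for `β`, and
    -- `σ β` is a conjugate of `β` other than `β`.
    have hne : σ β ≠ β := fun hσ =>
      haα (ringHom_eq_of_invariantModule_eq hO (τ := RingHom.id _) hσ)
    have hG := congrArg (fun p => p.eval (σ β)) (X_sub_C_mul_divByMonic β)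
    simp only [eval_mul, eval_sub, eval_X, eval_C, eval_map_algebraMap,
      aeval_ringHom_primMinpoly, mul_eq_zero, sub_eq_zero, hne, false_or] at hG
    rw [eval_divByMonic_eq_sum β _ hβ] at hG
    simp only [ringHom_pow_eq h σ] at hG
    have hσl : σ l ≠ 0 := (map_ne_zero σ).2 hl
    refine (mul_eq_zero.1 (?_ : σ l * P.eval (σ α) = 0)).resolve_left hσl
    rw [← hG, hP]
    simp only [eval_finsetSum, eval_mul, eval_C, eval_pow, eval_X, Finset.mul_sum, Finset.sum_mul]
    rw [Finset.sum_comm]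
    refine Finset.sum_congr rfl fun j _ => Finset.sum_congr rfl fun i _ => ?_
    simp only [zsmul_eq_mul]
    ring
  obtain ⟨c, hc⟩ := exists_eq_C_mul_divByMonic hdeg hroot
  refine ⟨c, fun i => ?_⟩
  have := congrArg (fun p => p.coeff (i : ℕ)) hc
  simp only [coeff_C_mul] at this
  rw [cofactor, ← this, hP]
  simp only [finsetSum_coeff, coeff_C_mul, coeff_X_pow, Fin.val_inj, mul_ite, mul_one, mul_zero,
    Finset.sum_ite_eq, Finset.mem_univ, if_true]

theorem inverseModule_eq_span_range {α : Qbar} {n : ℕ} (hα : algDegree α = n) :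
    inverseModule α = Submodule.span ℤ (Set.range fun i : Fin n => cofactor α i) := by
  refine le_antisymm (Submodule.span_le.2 ?_) (Submodule.span_mono ?_)
  · rintro _ ⟨k, rfl⟩
    by_cases hk : k < n
    · exact Submodule.subset_span ⟨⟨k, hk⟩, rfl⟩
    · rw [cofactor_eq_zero α (by omega)]
      exact Submodule.zero_mem _
  · rintro _ ⟨i, rfl⟩
    exact ⟨i, rfl⟩

/-- If `M_β = l M_α`, then `I_α` and `I_β` are homothetic. -/
theorem exists_idealModule_eq {α β l : Qbar} (hl : l ≠ 0)
    (h : powerModule β = Submodule.span ℤ {l} * powerModule α) :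
    ∃ m : Qbar, m ≠ 0 ∧ idealModule β = Submodule.span ℤ {m} * idealModule α := by
  have hO := invariantModule_eq_of_powerModule_eq hl h
  have hβ := (algDegree_eq_of_powerModule_eq hl h).symm
  obtain ⟨U, hU⟩ := exists_GL_of_powerModule_eq rfl hβ hl h
  obtain ⟨c, hc⟩ := exists_sum_cofactor_eq rfl hβ hO hl hU
  have hUt : U.val.transpose * U.inv.transpose = 1 := by
    rw [← Matrix.transpose_mul, U.inv_val, Matrix.transpose_one]
  have hUt' : U.inv.transpose * U.val.transpose = 1 := by
    rw [← Matrix.transpose_mul, U.val_inv, Matrix.transpose_one]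
  have hJ : inverseModule β = Submodule.span ℤ {c} * inverseModule α := by
    rw [inverseModule_eq_span_range hβ, inverseModule_eq_span_range (α := α) rfl,
      span_singleton_mul_span_range]
    exact (span_range_eq_of_GL ⟨_, _, hUt, hUt'⟩ fun i => (hc i).symm).symm
  have hc0 : c ≠ 0 := by
    rintro rfl
    have h1 : cofactor β (algDegree β - 1) ∈ inverseModule β := Submodule.subset_span ⟨_, rfl⟩
    rw [hJ, ← leadingCoeff_eq_cofactor, Submodule.mem_span_singleton_mul] at h1
    obtain ⟨z, -, hz⟩ := h1
    rw [zero_mul] at hz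
    exact leadingCoeff_cast_ne_zero β hz.symm
  exact ⟨c⁻¹, inv_ne_zero hc0, idealModule_eq_of_inverseModule_eq hc0 hO hJ⟩

/-! ### Linear forms -/

/-- The linear form `c₁ X₁ + ⋯ + cₙ Xₙ`. -/
noncomputable def linForm {n : ℕ} (c : Fin n → Qbar) : MvPolynomial (Fin n) Qbar :=
  ∑ i, MvPolynomial.C (c i) * MvPolynomial.X i

theorem coeff_linForm {n : ℕ} (c : Fin n → Qbar) (i : Fin n) :
    (linForm c).coeff (Finsupp.single i 1) = c i := by
  simp [linForm, MvPolynomial.coeff_sum, MvPolynomial.coeff_C_mul, MvPolynomial.coeff_X,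
    Finsupp.single_left_inj]

theorem linForm_const_mul {n : ℕ} (k : Qbar) (c : Fin n → Qbar) :
    linForm (fun i => k * c i) = MvPolynomial.C k * linForm c := by
  simp only [linForm, Finset.mul_sum, map_mul, mul_assoc]

theorem totalDegree_linForm_le {n : ℕ} (c : Fin n → Qbar) : (linForm c).totalDegree ≤ 1 := by
  refine MvPolynomial.totalDegree_finsetSum_le fun i _ => ?_
  rw [← MvPolynomial.smul_eq_C_mul]
  exact (MvPolynomial.totalDegree_smul_le _ _).trans (MvPolynomial.totalDegree_X _).le

theorem totalDegree_linForm {n : ℕ} {c : Fin n → Qbar} {i : Fin n} (hi : c i ≠ 0) :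
    (linForm c).totalDegree = 1 := by
  refine le_antisymm (totalDegree_linForm_le c) ?_
  have := MvPolynomial.le_totalDegree (p := linForm c) (s := Finsupp.single i 1)
    (by rw [MvPolynomial.mem_support_iff, coeff_linForm]; exact hi)
  simpa using this

theorem linForm_prime {n : ℕ} {c : Fin n → Qbar} {i : Fin n} (hi : c i ≠ 0) :
    Prime (linForm c) := by
  refine (MvPolynomial.irreducible_of_totalDegree_eq_one (totalDegree_linForm hi)
    fun x hx => ?_).prime
  have := hx (Finsupp.single i 1)
  rw [coeff_linForm] at this
  exact isUnit_iff_ne_zero.2 (ne_zero_of_dvd_ne_zero hi this)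

theorem exists_eq_mul_of_linForm_dvd {n : ℕ} {c d : Fin n → Qbar} {i : Fin n} (hi : d i ≠ 0)
    (h : linForm d ∣ linForm c) : ∃ k : Qbar, ∀ j, c j = k * d j := by
  obtain ⟨q, hq⟩ := h
  have hq0 : q.totalDegree = 0 := by
    by_cases hq0 : q = 0
    · simp [hq0]
    have h1 := totalDegree_linForm_le c
    rw [hq, MvPolynomial.totalDegree_mul_of_isDomain (linForm_prime hi).ne_zero hq0,
      totalDegree_linForm hi] at h1
    omega
  rw [MvPolynomial.totalDegree_eq_zero_iff_eq_C] at hq0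
  refine ⟨q.coeff 0, fun j => ?_⟩
  rw [hq0, mul_comm, ← linForm_const_mul] at hq
  rw [← coeff_linForm c, hq, coeff_linForm]

theorem decomposableForm_eq (n : ℕ) (f : ℤ[X]) : decomposableForm n f =
    MvPolynomial.C ((f.leadingCoeff : Qbar) ^ (n - 1)) *
      ((f.aroots Qbar).map fun a : Qbar => linForm fun i : Fin n => a ^ (i : ℕ)).prod := rfl

theorem substMatrix_linForm {n : ℕ} (U : Matrix (Fin n) (Fin n) ℤ) (c : Fin n → Qbar) :
    substMatrix U (linForm c) = linForm fun j => ∑ i, U i j • c i := by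
  simp only [substMatrix, linForm, map_sum, map_mul, MvPolynomial.bind₁_C_right,
    MvPolynomial.bind₁_X_right, Finset.mul_sum, Finset.sum_mul, zsmul_eq_mul]
  rw [Finset.sum_comm]
  refine Finset.sum_congr rfl fun j _ => Finset.sum_congr rfl fun i _ => ?_
  ring

theorem substMatrix_C_mul_prod {n : ℕ} (U : Matrix (Fin n) (Fin n) ℤ) (k : Qbar)
    (s : Multiset Qbar) (c : Qbar → Fin n → Qbar) :
    substMatrix U (MvPolynomial.C k * (s.map fun a => linForm (c a)).prod) =
      MvPolynomial.C k * (s.map fun a => linForm fun j => ∑ i, U i j • c a i).prod := by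
  simp only [← substMatrix_linForm]
  simp only [substMatrix, map_mul, map_multiset_prod, Multiset.map_map, MvPolynomial.bind₁_C_right,
    Function.comp_def]

/-! ### Hermite equivalence and modules of powers -/

theorem algDegree_eq_natDegree {f : ℤ[X]} (hf : Irreducible f) {α : Qbar} (h : aeval α f = 0) :
    algDegree α = f.natDegree := by
  rcases eq_or_eq_neg_primMinpoly hf h with rfl | hf
  · rw [algDegree]
  · rw [hf, natDegree_neg, algDegree]

theorem aroots_eq {f : ℤ[X]} (hf : Irreducible f) {α : Qbar} (h : aeval α f = 0) :
    f.aroots Qbar = (primMinpoly α).aroots Qbar := by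
  rcases eq_or_eq_neg_primMinpoly hf h with h | h
  · rw [h]
  · rw [h, aroots_neg]

theorem exists_root {f : ℤ[X]} (hf : f.IsPrimitive) (hf' : Irreducible f) :
    ∃ α : Qbar, aeval α f = 0 := by
  refine IsAlgClosed.exists_aeval_eq_zero_of_injective Qbar (algebraMap ℤ Qbar).injective_int f ?_
  intro h
  obtain ⟨c, rfl⟩ := natDegree_eq_zero.1 (natDegree_eq_of_degree_eq_some h)
  exact hf'.not_isUnit ((hf c dvd_rfl).map C)

/-- A linear factor of `[g]` divides a linear factor of `[f](U X)`, and both are proportional. -/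
theorem HermiteEquivalent.exists_powerModule_eq {f g : ℤ[X]} (hf' : Irreducible f)
    (hg : g.IsPrimitive) (hg' : Irreducible g) (h : HermiteEquivalent f g) :
    ∃ α β l : Qbar, aeval α f = 0 ∧ aeval β g = 0 ∧ l ≠ 0 ∧
      powerModule β = Submodule.span ℤ {l} * powerModule α := by
  obtain ⟨n, hfn, hgn, U, hU⟩ := h
  obtain ⟨β, hβ⟩ := exists_root hg hg'
  have hβn : algDegree β = n := (algDegree_eq_natDegree hg' hβ).trans hgn
  have hn : 0 < n := hβn ▸ algDegree_pos β
  have h0 : (fun i : Fin n => β ^ (i : ℕ)) ⟨0, hn⟩ ≠ 0 := by simp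
  have hp := linForm_prime (c := fun i : Fin n => β ^ (i : ℕ)) h0
  have hdvd : linForm (fun i : Fin n => β ^ (i : ℕ)) ∣
      substMatrix U.val (decomposableForm n f) := by
    have h1 : linForm (fun i : Fin n => β ^ (i : ℕ)) ∣ decomposableForm n g := by
      rw [decomposableForm_eq]
      refine dvd_mul_of_dvd_right (Multiset.dvd_prod (Multiset.mem_map.2 ⟨β, ?_, rfl⟩)) _
      exact mem_aroots.2 ⟨hg'.ne_zero, hβ⟩
    rcases hU with hU | hU
    · rwa [hU] at h1
    · rwa [hU, dvd_neg] at h1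
  rw [decomposableForm_eq,
    substMatrix_C_mul_prod U.val _ _ fun a (i : Fin n) => a ^ (i : ℕ)] at hdvd
  rcases hp.dvd_or_dvd hdvd with hdvd | hdvd
  · exfalso
    refine hp.not_isUnit (isUnit_of_dvd_unit hdvd (IsUnit.map MvPolynomial.C ?_))
    exact isUnit_iff_ne_zero.2
      (pow_ne_zero _ (Int.cast_ne_zero.2 (leadingCoeff_ne_zero.2 hf'.ne_zero)))
  obtain ⟨α, hα, hdvd⟩ := hp.exists_mem_multiset_map_dvd hdvd
  obtain ⟨k, hk⟩ :=
    exists_eq_mul_of_linForm_dvd (d := fun i : Fin n => β ^ (i : ℕ)) h0 hdvd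
  have hα := (mem_aroots.1 hα).2
  have hαn : algDegree α = n := (algDegree_eq_natDegree hf' hα).trans hfn
  have h1 : powerModule α = Submodule.span ℤ {k} * powerModule β := by
    rw [powerModule_eq_span_range_of_algDegree_eq hαn,
      powerModule_eq_span_range_of_algDegree_eq hβn, span_singleton_mul_span_range]
    exact (span_range_eq_of_GL U fun j => (hk j).symm).symm
  have hk0 : k ≠ 0 := by
    rintro rfl
    have h2 := invariantModule_le_powerModule α (one_mem_invariantModule α)
    rw [h1, Submodule.mem_span_singleton_mul] at h2
    obtain ⟨z, -, hz⟩ := h2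
    simp at hz
  refine ⟨α, β, k⁻¹, hα, hβ, inv_ne_zero hk0, ?_⟩
  rw [h1, ← mul_assoc, mul_comm (Submodule.span ℤ {k⁻¹}), span_singleton_mul_span_inv hk0, one_mul]

theorem exists_order_basis {α : Qbar} {n : ℕ} (hα : algDegree α = n) :
    ∃ (w : Fin n → Qbar) (T : Matrix (Fin n) (Fin n) ℤ), LinearIndependent ℤ w ∧
      invariantModule α = Submodule.span ℤ (Set.range w) ∧
      (∀ k, w k = ∑ i : Fin n, T i k • α ^ (i : ℕ)) ∧
      T.det = (primMinpoly α).leadingCoeff ^ (n - 1) := by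
  subst hα
  exact ⟨orderVec α, orderMatrix α, linearIndependent_orderVec α, invariantModule_eq_span_range α,
    orderVec_eq_sum α, det_orderMatrix α⟩

theorem det_GL_eq {n : ℕ} (U : Matrix.GeneralLinearGroup (Fin n) ℤ) :
    U.val.det = 1 ∨ U.val.det = -1 :=
  Int.isUnit_iff.1 ((Matrix.isUnit_iff_isUnit_det _).1 U.isUnit)

/-- The norm of the ratio `l` of two homothetic modules of powers, computed from the
determinants of these modules relative to the common invariant order. -/
theorem prod_conjugates_eq {α β l : Qbar} {n : ℕ} (hα : algDegree α = n)
    (hβ : algDegree β = n) (hO : invariantModule α = invariantModule β)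
    (U : Matrix.GeneralLinearGroup (Fin n) ℤ)
    (h : ∀ j : Fin n, β ^ (j : ℕ) = l * ∑ i : Fin n, U.val i j • α ^ (i : ℕ))
    {σ : Fin n → Qbar →+* Qbar} (hσ : Function.Injective fun i => σ i α) :
    (∏ i, σ i l) * ((primMinpoly β).leadingCoeff : Qbar) ^ (n - 1) =
        ((primMinpoly α).leadingCoeff : Qbar) ^ (n - 1) ∨
      (∏ i, σ i l) * ((primMinpoly β).leadingCoeff : Qbar) ^ (n - 1) =
        -((primMinpoly α).leadingCoeff : Qbar) ^ (n - 1) := by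
  obtain ⟨w, T, hw, hws, hwT, hT⟩ := exists_order_basis hα
  obtain ⟨w', T', hw', hws', hwT', hT'⟩ := exists_order_basis hβ
  obtain ⟨W, hW⟩ := exists_GL_of_span_eq hw hw' (by rw [← hws, ← hws', hO])
  -- Both `V T W` and `diag (σ l) V U T'` are the matrix of conjugates of the basis `w'`.
  let φ : ℤ →+* Qbar := Int.castRingHom Qbar
  let V : Matrix (Fin n) (Fin n) Qbar := Matrix.vandermonde fun i => σ i α
  have hV : V.det ≠ 0 := Matrix.det_vandermonde_ne_zero_iff.2 hσ
  have h1 : V * φ.mapMatrix T = Matrix.of fun i k => σ i (w k) := by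
    ext i k
    simp [V, φ, Matrix.mul_apply, Matrix.vandermonde_apply, hwT, mul_comm]
  have h2 : V * φ.mapMatrix T * φ.mapMatrix W.val = Matrix.of fun i k => σ i (w' k) := by
    rw [h1]
    ext i k
    simp [φ, Matrix.mul_apply, hW, mul_comm]
  have h3 : Matrix.diagonal (fun i => σ i l) * V * φ.mapMatrix U.val =
      Matrix.of fun i k : Fin n => σ i β ^ (k : ℕ) := by
    ext i k
    rw [Matrix.of_apply, ringHom_pow_eq h, mul_assoc, Matrix.diagonal_mul]
    simp [V, φ, Matrix.mul_apply, Matrix.vandermonde_apply, mul_comm]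
  have h4 : Matrix.diagonal (fun i => σ i l) * V * φ.mapMatrix U.val * φ.mapMatrix T' =
      Matrix.of fun i k => σ i (w' k) := by
    rw [h3]
    ext i k
    simp [φ, Matrix.mul_apply, hwT', mul_comm]
  have h5 := congrArg Matrix.det (h4.trans h2.symm)
  rw [Matrix.det_mul, Matrix.det_mul, Matrix.det_mul, Matrix.det_mul, Matrix.det_mul,
    Matrix.det_diagonal, ← RingHom.map_det, ← RingHom.map_det, ← RingHom.map_det,
    ← RingHom.map_det, hT, hT'] at h5
  have h6 : (∏ i, σ i l) * ((primMinpoly β).leadingCoeff : Qbar) ^ (n - 1) * φ U.val.det =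
      ((primMinpoly α).leadingCoeff : Qbar) ^ (n - 1) * φ W.val.det := by
    refine mul_left_cancel₀ hV ?_
    simp only [φ, eq_intCast, Int.cast_pow] at h5 ⊢
    linear_combination h5
  rcases det_GL_eq U with hU | hU <;> rcases det_GL_eq W with hW' | hW' <;>
    rw [hU, hW'] at h6
  · left; simpa using h6
  · right; simpa using h6
  · right; simpa [neg_eq_iff_eq_neg] using h6
  · left; simpa using h6

theorem leadingCoeff_pow_eq {f : ℤ[X]} (hf : Irreducible f) {α : Qbar} (h : aeval α f = 0)
    (m : ℕ) : (f.leadingCoeff : Qbar) ^ m = ((primMinpoly α).leadingCoeff : Qbar) ^ m ∨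
      (f.leadingCoeff : Qbar) ^ m = -((primMinpoly α).leadingCoeff : Qbar) ^ m := by
  rcases eq_or_eq_neg_primMinpoly hf h with h | h
  · left; rw [h]
  · rw [h, leadingCoeff_neg, Int.cast_neg]
    rcases Nat.even_or_odd m with hm | hm
    · left; exact hm.neg_pow _
    · right; exact hm.neg_pow _

/-- `[g]` is a constant times `[f](U X)`, by matching the conjugate linear factors; the constant
is `±1` by `prod_conjugates_eq`. -/
theorem hermiteEquivalent_of_powerModule_eq {f g : ℤ[X]} (hf' : Irreducible f)
    (hg' : Irreducible g) {α β l : Qbar} (hα : aeval α f = 0) (hβ : aeval β g = 0) (hl : l ≠ 0)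
    (h : powerModule β = Submodule.span ℤ {l} * powerModule α) : HermiteEquivalent f g := by
  have hO := invariantModule_eq_of_powerModule_eq hl h
  have hd := algDegree_eq_of_powerModule_eq hl h
  obtain ⟨n, hαn⟩ : ∃ n, algDegree α = n := ⟨_, rfl⟩
  have hβn : algDegree β = n := hd.symm.trans hαn
  obtain ⟨U, hU⟩ := exists_GL_of_powerModule_eq hαn hβn hl h
  obtain ⟨σ, hσ, hσα⟩ : ∃ σ : Fin n → Qbar →+* Qbar, Function.Injective (fun i => σ i α) ∧
      (primMinpoly α).aroots Qbar = Finset.univ.val.map fun i => σ i α := by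
    subst hαn; exact exists_conjugates α
  have hσβinj : Function.Injective fun i => σ i β :=
    fun i j hij => hσ (ringHom_eq_of_invariantModule_eq hO hij)
  have hσβ : (primMinpoly β).aroots Qbar = Finset.univ.val.map fun i => σ i β := by
    symm
    refine Multiset.eq_of_le_of_card_le ?_ ?_
    · refine (Multiset.le_iff_subset (Finset.univ.nodup.map hσβinj)).2 fun x hx => ?_
      obtain ⟨i, -, rfl⟩ := Multiset.mem_map.1 hx
      exact mem_aroots.2 ⟨(primMinpoly_spec β).2.1.ne_zero, aeval_ringHom_primMinpoly _ _⟩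
    · rw [card_aroots_primMinpoly, hβn]
      simp
  refine ⟨n, (algDegree_eq_natDegree hf' hα).symm.trans hαn,
    (algDegree_eq_natDegree hg' hβ).symm.trans hβn, U, ?_⟩
  rw [decomposableForm_eq n f,
    substMatrix_C_mul_prod U.val _ _ fun a (i : Fin n) => a ^ (i : ℕ), decomposableForm_eq,
    aroots_eq hf' hα, aroots_eq hg' hβ, hσα, hσβ, Multiset.map_map, Multiset.map_map]
  simp only [Function.comp_def, ringHom_pow_eq hU, linForm_const_mul, Multiset.prod_map_mul]
  rw [← mul_assoc, ← neg_mul, ← map_neg]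
  have key : (g.leadingCoeff : Qbar) ^ (n - 1) * ∏ i, σ i l = (f.leadingCoeff : Qbar) ^ (n - 1) ∨
      (g.leadingCoeff : Qbar) ^ (n - 1) * ∏ i, σ i l = -(f.leadingCoeff : Qbar) ^ (n - 1) := by
    rw [mul_comm]
    rcases leadingCoeff_pow_eq hf' hα (n - 1) with h1 | h1 <;>
      rcases leadingCoeff_pow_eq hg' hβ (n - 1) with h2 | h2 <;>
      rcases prod_conjugates_eq hαn hβn hO U hU hσ with h3 | h3 <;>
      simp only [h1, h2, h3, mul_neg, neg_neg, true_or, or_true]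
  have hC : (Multiset.map (fun i => MvPolynomial.C (σ := Fin n) (σ i l)) Finset.univ.val).prod =
      MvPolynomial.C (∏ i, σ i l) := by
    rw [map_prod]; rfl
  rw [hC, ← map_mul]
  rcases key with key | key
  · left; rw [key]
  · right; rw [key]

/-! ### Ideal classes -/

section IdealClass

variable {L : Type*} [Field L] {O : Subring L}

theorem LiesInIdealClass.exists_mul {c : ClassGroup O} {I I' : Set L}
    (h : LiesInIdealClass O c I) (h' : LiesInIdealClass O c I') :
    ∃ m : L, m ≠ 0 ∧ ∀ x, x ∈ I' ↔ ∃ y ∈ I, m * y = x := by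
  obtain ⟨J, hJ, rfl⟩ := h
  obtain ⟨J', hJ', rfl⟩ := h'
  obtain ⟨x, rfl⟩ := ClassGroup.mk_eq_mk.1 (hJ.trans hJ'.symm)
  refine ⟨IsFractionRing.lift (K := FractionRing O) O.subtype_injective x,
    (_root_.map_ne_zero _).2 x.ne_zero, fun z => ?_⟩
  simp only [Units.val_mul, coe_toPrincipalIdeal, mul_comm J.val,
    Set.mem_image, Set.mem_ofPred_eq, FractionalIdeal.mem_singleton_mul]
  constructor
  · rintro ⟨_, ⟨y, hy, rfl⟩, rfl⟩
    exact ⟨_, ⟨y, hy, rfl⟩, (map_mul _ _ _).symm⟩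
  · rintro ⟨_, ⟨y, hy, rfl⟩, rfl⟩
    exact ⟨_, ⟨y, hy, rfl⟩, map_mul _ _ _⟩

/-- The factor `m` has to come from the fraction field of `O`, which need not be all of `L`. -/
theorem LiesInIdealClass.mul {c : ClassGroup O} {I I' : Set L} (h : LiesInIdealClass O c I)
    {m : L} (hm : m ≠ 0)
    (hmr : m ∈ (IsFractionRing.lift (K := FractionRing O) O.subtype_injective).fieldRange)
    (hI' : ∀ x, x ∈ I' ↔ ∃ y ∈ I, m * y = x) : LiesInIdealClass O c I' := by
  obtain ⟨J, hJ, rfl⟩ := h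
  obtain ⟨x, rfl⟩ := hmr
  have hx : x ≠ 0 := (_root_.map_ne_zero _).1 hm
  refine ⟨J * toPrincipalIdeal O (FractionRing O) (Units.mk0 x hx),
    (ClassGroup.mk_eq_mk.2 ⟨_, rfl⟩).symm.trans hJ, ?_⟩
  ext z
  simp only [hI', Units.val_mul, coe_toPrincipalIdeal, mul_comm J.val,
    Set.mem_image, Set.mem_ofPred_eq, FractionalIdeal.mem_singleton_mul, Units.val_mk0]
  constructor
  · rintro ⟨_, ⟨y, hy, rfl⟩, rfl⟩
    exact ⟨_, ⟨y, hy, rfl⟩, (map_mul _ _ _).symm⟩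
  · rintro ⟨_, ⟨y, hy, rfl⟩, rfl⟩
    exact ⟨_, ⟨y, hy, rfl⟩, map_mul _ _ _⟩

theorem mem_fieldRange_lift {x : L} (hx : x ∈ O) :
    x ∈ (IsFractionRing.lift (K := FractionRing O) O.subtype_injective).fieldRange :=
  ⟨algebraMap O _ ⟨x, hx⟩, IsFractionRing.lift_algebraMap _ _⟩

/-- An `O`-submodule of the fraction field of `O` inside `L` with an inverse lies in a class. -/
theorem exists_liesInIdealClass {N N' : Submodule O L} (h : N * N' = 1)
    (hN : ∀ x ∈ N, x ∈ (IsFractionRing.lift (K := FractionRing O) O.subtype_injective).fieldRange)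
    (hN' : ∀ x ∈ N',
      x ∈ (IsFractionRing.lift (K := FractionRing O) O.subtype_injective).fieldRange) :
    ∃ c, LiesInIdealClass O c (N : Set L) := by
  -- The fractional ideal and its inverse are the preimages of `N` and `N'`.
  let ι : FractionRing O →ₐ[O] L :=
    { IsFractionRing.lift (K := FractionRing O) O.subtype_injective with
      commutes' := fun r => IsFractionRing.lift_algebraMap _ r }
  have hι : Function.Injective ι := ι.toRingHom.injective
  have hmap : ∀ M : Submodule O L, (∀ x ∈ M,
      x ∈ (IsFractionRing.lift (K := FractionRing O) O.subtype_injective).fieldRange) →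
      (M.comap ι.toLinearMap).map ι.toLinearMap = M := fun M hM =>
    Submodule.map_comap_eq_self fun x hx => hM x hx
  have h1 : N.comap ι.toLinearMap * N'.comap ι.toLinearMap = 1 := by
    refine Submodule.map_injective_of_injective (f := ι.toLinearMap) hι ?_
    rw [Submodule.map_mul, hmap N hN, hmap N' hN', h, Submodule.map_one]
  have hfg : ∀ M M' : Submodule O (FractionRing O), M * M' = 1 →
      IsFractional (nonZeroDivisors O) M := fun M M' h =>
    FractionalIdeal.isFractional_of_fg (Submodule.fg_of_isUnit (IsUnit.of_mul_eq_one _ h))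
  have h1' := (mul_comm _ _).trans h1
  let J : FractionalIdeal (nonZeroDivisors O) (FractionRing O) := ⟨_, hfg _ _ h1⟩
  let J' : FractionalIdeal (nonZeroDivisors O) (FractionRing O) := ⟨_, hfg _ _ h1'⟩
  have hJ : J * J' = 1 := by
    rw [← FractionalIdeal.coeToSubmodule_inj, FractionalIdeal.coe_mul, FractionalIdeal.coe_one]
    exact h1
  refine ⟨_, ⟨J, J', hJ, (mul_comm _ _).trans hJ⟩, rfl, ?_⟩
  exact congrArg (fun M : Submodule O L => (M : Set L)) (hmap N hN)

theorem mem_span_mul_span_of_int {S T : Set L} {x : L}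
    (hx : x ∈ Submodule.span ℤ S * Submodule.span ℤ T) :
    x ∈ Submodule.span O S * Submodule.span O T := by
  rw [Submodule.span_mul_span] at hx ⊢
  exact Submodule.span_le_restrictScalars ℤ O _ hx

end IdealClass

theorem mem_invariantIdeal_iff {α x : Qbar} : x ∈ invariantIdeal α ↔ x ∈ idealModule α := by
  constructor
  · intro h
    obtain ⟨a, b, rfl⟩ := Submodule.mem_span_pair.1 h
    exact Submodule.add_mem _
      (Submodule.mul_mem_mul a.2 (Submodule.subset_span (Or.inl rfl)))
      (Submodule.mul_mem_mul b.2 (Submodule.subset_span (Or.inr rfl)))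
  · intro h
    have hle : idealModule α ≤ (invariantIdeal α).restrictScalars ℤ := by
      refine Submodule.mul_le.2 fun a ha y hy => ?_
      exact (invariantIdeal α).smul_mem (⟨a, ha⟩ : invariantOrder α)
        (Submodule.span_le_restrictScalars ℤ (invariantOrder α) _ hy)
    exact hle h

theorem mem_fieldRange_of_mem_idealModule {α x : Qbar} (hx : x ∈ idealModule α) :
    x ∈ (IsFractionRing.lift (K := FractionRing (invariantOrder α))
      (invariantOrder α).subtype_injective).fieldRange := by
  obtain ⟨a, b, rfl⟩ := Submodule.mem_span_pair.1 (mem_invariantIdeal_iff.2 hx)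
  set R := (IsFractionRing.lift (K := FractionRing (invariantOrder α))
      (invariantOrder α).subtype_injective).fieldRange
  have hα : α ∈ R := by
    have h1 : ((primMinpoly α).leadingCoeff : Qbar) * α ∈ R :=
      mem_fieldRange_lift (O := invariantOrder α) (leadingCoeff_mul_mem α)
    have h2 := R.mul_mem (R.inv_mem (intCast_mem R (primMinpoly α).leadingCoeff)) h1
    rwa [inv_mul_cancel_left₀ (leadingCoeff_cast_ne_zero α)] at h2
  exact R.add_mem (R.mul_mem (mem_fieldRange_lift a.2) R.one_mem)
    (R.mul_mem (mem_fieldRange_lift b.2) hα)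

theorem exists_liesInIdealClass_invariantIdeal (α : Qbar) :
    ∃ c, LiesInIdealClass (invariantOrder α) c (invariantIdeal α) := by
  have hJ : ∀ x ∈ Submodule.span (invariantOrder α) (Set.range (cofactor α)),
      x ∈ invariantOrder α := by
    intro x hx
    induction hx using Submodule.span_induction with
    | mem x h => obtain ⟨k, rfl⟩ := h; exact cofactor_mem_invariantModule α k
    | zero => exact (invariantOrder α).zero_mem
    | add x y _ _ hx hy => exact (invariantOrder α).add_mem hx hy
    | smul a x _ hx => exact (invariantOrder α).mul_mem a.2 hx
  refine exists_liesInIdealClass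
    (N' := Submodule.span (invariantOrder α) (Set.range (cofactor α))) ?_
    (fun x hx => mem_fieldRange_of_mem_idealModule (mem_invariantIdeal_iff.1 hx))
    (fun x hx => mem_fieldRange_lift (hJ x hx))
  refine le_antisymm ?_ (Submodule.one_le.2 ?_)
  · have h1 : ∀ z ∈ invariantModule α, z ∈ (1 : Submodule (invariantOrder α) Qbar) :=
      fun z hz => Submodule.mem_one.2 ⟨⟨z, hz⟩, rfl⟩
    rw [invariantIdeal, Submodule.span_mul_span, Submodule.span_le]
    rintro z ⟨x, hx, _, ⟨k, rfl⟩, rfl⟩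
    refine h1 _ ?_
    change x * cofactor α k ∈ invariantModule α
    rcases hx with hx | hx
    · rw [hx, one_mul]
      exact cofactor_mem_invariantModule α k
    · rw [hx]
      exact mul_cofactor_mem_invariantModule α k
  · exact mem_span_mul_span_of_int (one_mem_span_mul_inverseModule α)

/-- For equal invariant orders, the invariant ideals lie in the same class exactly when they are
homothetic. -/
theorem exists_liesInIdealClass_iff {α β : Qbar} (hO : invariantOrder α = invariantOrder β) :
    (∃ c : ClassGroup (invariantOrder α),
        LiesInIdealClass (invariantOrder α) c (invariantIdeal α) ∧
        LiesInIdealClass (invariantOrder α) c (invariantIdeal β)) ↔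
      ∃ m : Qbar, m ≠ 0 ∧ idealModule β = Submodule.span ℤ {m} * idealModule α := by
  constructor
  · rintro ⟨c, h1, h2⟩
    obtain ⟨m, hm, h⟩ := h1.exists_mul h2
    refine ⟨m, hm, ?_⟩
    ext x
    rw [Submodule.mem_span_singleton_mul, ← mem_invariantIdeal_iff]
    simp only [← mem_invariantIdeal_iff]
    exact h x
  · rintro ⟨m, hm, h⟩
    obtain ⟨c, hc⟩ := exists_liesInIdealClass_invariantIdeal α
    have h1 : ∀ γ, (1 : Qbar) ∈ idealModule γ := fun γ =>
      mem_invariantIdeal_iff.1 (Submodule.subset_span (Or.inl rfl))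
    have hmβ : m ∈ idealModule β := by
      rw [h, Submodule.mem_span_singleton_mul]
      exact ⟨1, h1 α, mul_one m⟩
    have hmr := mem_fieldRange_of_mem_idealModule hmβ
    rw [← hO] at hmr
    refine ⟨c, hc, hc.mul hm hmr fun x => ?_⟩
    change x ∈ invariantIdeal β ↔ ∃ y ∈ invariantIdeal α, m * y = x
    simp only [mem_invariantIdeal_iff, h, Submodule.mem_span_singleton_mul]

theorem invariantOrder_eq_iff {α β : Qbar} :
    invariantOrder α = invariantOrder β ↔ invariantModule α = invariantModule β := by
  rw [SetLike.ext_iff, SetLike.ext_iff]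
  rfl

/-! ### The monic case -/

/-- For an algebraic integer, the module of powers is the ring `ℤ[α]`. -/
theorem mem_powerModule_iff_of_monic {α x : Qbar} {f : ℤ[X]} (hf : f.Monic) (hf' : Irreducible f)
    (hα : aeval α f = 0) : x ∈ powerModule α ↔ x ∈ Algebra.adjoin ℤ {α} := by
  rw [mem_powerModule, Algebra.adjoin_singleton_eq_range_aeval, AlgHom.mem_range]
  constructor
  · rintro ⟨p, -, rfl⟩
    exact ⟨p, rfl⟩
  · rintro ⟨p, rfl⟩
    refine ⟨p %ₘ f, ?_, ?_⟩
    · rw [algDegree_eq_natDegree hf' hα]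
      refine natDegree_modByMonic_lt _ hf ?_
      rintro rfl
      exact hf'.not_isUnit isUnit_one
    · conv_rhs => rw [← modByMonic_add_div p f]
      simp [hα]

theorem mem_invariantModule_iff_of_monic {α x : Qbar} {f : ℤ[X]} (hf : f.Monic)
    (hf' : Irreducible f) (hα : aeval α f = 0) :
    x ∈ invariantModule α ↔ x ∈ Algebra.adjoin ℤ {α} := by
  refine ⟨fun h => (mem_powerModule_iff_of_monic hf hf' hα).1
    (invariantModule_le_powerModule α h), fun h => ?_⟩
  rw [mem_invariantModule_iff]
  simp only [mem_powerModule_iff_of_monic hf hf' hα]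
  exact fun y hy => mul_mem h hy

/-! ### The equivalence -/

theorem theoremB5 (f g : ℤ[X]) (hf : f.IsPrimitive) (hf' : Irreducible f)
    (hg : g.IsPrimitive) (hg' : Irreducible g) :
    (HermiteEquivalent f g ↔
      ∃ α β : Qbar, aeval α f = 0 ∧ aeval β g = 0 ∧ invariantOrder α = invariantOrder β ∧
        ∃ c : ClassGroup (invariantOrder α),
          LiesInIdealClass (invariantOrder α) c (invariantIdeal α) ∧
          LiesInIdealClass (invariantOrder α) c (invariantIdeal β)) ∧
    (f.Monic → g.Monic →
      (HermiteEquivalent f g ↔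
        ∃ α β : Qbar, aeval α f = 0 ∧ aeval β g = 0 ∧
          Algebra.adjoin ℤ {α} = Algebra.adjoin ℤ {β})) := by
  refine ⟨⟨fun h => ?_, ?_⟩, fun hfm hgm => ⟨fun h => ?_, ?_⟩⟩
  · obtain ⟨α, β, l, hα, hβ, hl, hM⟩ := h.exists_powerModule_eq hf' hg hg'
    have hO := invariantOrder_eq_iff.2 (invariantModule_eq_of_powerModule_eq hl hM)
    exact ⟨α, β, hα, hβ, hO, (exists_liesInIdealClass_iff hO).2 (exists_idealModule_eq hl hM)⟩
  · rintro ⟨α, β, hα, hβ, hO, hc⟩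
    obtain ⟨m, hm, hI⟩ := (exists_liesInIdealClass_iff hO).1 hc
    exact hermiteEquivalent_of_powerModule_eq hf' hg' hα hβ (pow_ne_zero _ hm)
      (powerModule_eq_of_idealModule_eq (invariantOrder_eq_iff.1 hO) hI)
  · obtain ⟨α, β, l, hα, hβ, hl, hM⟩ := h.exists_powerModule_eq hf' hg hg'
    refine ⟨α, β, hα, hβ, ?_⟩
    ext x
    rw [← mem_invariantModule_iff_of_monic hfm hf' hα,
      ← mem_invariantModule_iff_of_monic hgm hg' hβ, invariantModule_eq_of_powerModule_eq hl hM]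
  · rintro ⟨α, β, hα, hβ, h⟩
    refine hermiteEquivalent_of_powerModule_eq hf' hg' hα hβ one_ne_zero ?_
    rw [← Submodule.one_eq_span, one_mul]
    ext x
    rw [mem_powerModule_iff_of_monic hfm hf' hα, mem_powerModule_iff_of_monic hgm hg' hβ, h]
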